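/- Let $p$ be a prime, $q$ a power of $p$, $n\ge 1$, and $G_t=\mathrm{GL}_t(\mathbb F_q)$ (with $G_0$ trivial). Let $P_t\subset G_t$ be the subgroup of matrices with bottom row $(0,\dots,0,1)$, $U_t\subset P_t$ the subgroup of matrices $\begin{pmatrix} I_{t-1}&y\\0&1\end{pmatrix}$, and $N_t\subset G_t$ the subgroup of unipotent upper triangular matrices. Let $A$ be a nonzero commutative $\mathbb Z[1/p,\zeta_p]$-algebra, $\psi_0:\mathbb F_q\to\mathbb Z[1/p,\zeta_p]^\times$ a nontrivial character, and $\psi:\mathbb F_q\to A^\times$ the character it induces. *Derivatives.* For an $A[P_t]$-module $V$, let $\Psi^-V$ be the $A[G_{t-1}]$-module of $U_t$-coinvariants of $V$, and, for $t\ge2$, let $\Phi^-_\psi V$ be the $A[P_{t-1}]$-module of coinvariants of $V$ for $U_t$ and the character $\begin{pmatrix} I_{t-1}&y\\0&1\end{pmatrix}\mapsto\psi(y_{t-1})$. For an $A[G_n]$-module $V$ put $V^{(0)}=V$ and $V^{(k)}=\Psi^-(\Phi^-_\psi)^{k-1}(V|_{P_n})$ for $1\le k\le n$, an $A[G_{n-k}]$-module.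 One says that $V$ is of *Whittaker type* if $V^{(n)}$ is a free $A$-module of rank one. Its *Whittaker model* $\mathcal W(V,\psi)$ is then the image of the map $V\to\mathrm{Ind}_{N_n}^{G_n}\psi$, $v\mapsto\big(g\mapsto\lambda(\overline{gv})\big)$, where $v\mapsto\bar v$ is the projection $V\to V^{(n)}$, $\lambda$ is a generator of $\mathrm{Hom}_A(V^{(n)},A)$, and $\psi(u)=\psi\big(\sum_i u_{i,i+1}\big)$ for $u\in N_n$; $G_n$ acts on functions on $G_n$ by right translation. Whittaker type does not change if $\psi$ is replaced by $\psi^{-1}$, and $\mathcal W(V,\psi^{-1})$ is defined in the same way with $\psi^{-1}$ in place of $\psi$. *Exceptional pairs.* Let $V,V'$ be $A[G_n]$-modules of Whittaker type, with actions $\pi,\pi'$, and put $\mathcal W=\mathcal W(V,\psi)$, $\mathcal W'=\mathcal W(V',\psi^{-1})$. The pair $(V,V')$ is *exceptional* if for some $t\in\{1,\dots,n\}$ there is a nonzero $G_t$-invariant $A$-bilinear form $\mathcal W^{(n-t)}\times(\mathcal W')^{(n-t)}\to A$, where the derivatives of $\mathcal W$ are taken with respect to $\psi$ and those of $\mathcal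 W'$ with respect to $\psi^{-1}$. *Forms.* Let $C(\mathbb F_q^n,A)$ be the $A$-module of functions on row vectors $\mathbb F_q^n\to A$, with $(g\cdot\Phi)(x)=\Phi(xg)$. Let $\eta=(0,\dots,0,1)$, let $w_n$ be the antidiagonal permutation matrix, and put $$I(W,W',\Phi)=\sum_{g\in N_n\backslash G_n}W(g)W'(g)\Phi(\eta g),\qquad \widetilde W(g)=W(w_n\,{}^tg^{-1}),\qquad \widehat\Phi(a)=\sum_{x\in\mathbb F_q^n}\Phi(x)\psi(a\cdot x).$$ **Theorem.** Suppose that $V$ and $V'$ are of Whittaker type and that $(V,V')$ is not an exceptional pair. Then the $A$-module of $G_n$-invariant $A$-trilinear forms $\mathcal W\times\mathcal W'\times C(\mathbb F_q^n,A)\to A$ is free of rank one, and the form $(W,W',\Phi)\mapsto I(W,W',\Phi)$ belongs to it and generates it. Moreover, there is a unique $\gamma(\pi\times\pi',\psi)\in A^\times$ such that $$I(W,W',\Phi)\,\gamma(\pi\times\pi',\psi)=I(\widetilde W,\widetilde W',\widehat\Phi)$$ for all $W\in\mathcal W$, $W'\in\mathcal W'$ and $\Phi\in C(\mathbb F_q^n,A)$.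 -/

import Mathlib

open Matrix

namespace FiniteWhittaker

noncomputable section

/-! ### The coefficient base ring `ℤ[1/p, ζ_p]` -/

/-- The ring `ℤ[1/p, ζ_p]`: the ring `ℤ[ζ_p]` with `p` inverted. -/
abbrev BaseRing (p : ℕ) : Type :=
  Localization.Away (p : CyclotomicRing p ℤ ℚ)

/-- The extension `ψ_R : F → Rˣ` of `ψ : F → ℤ[1/p, ζ_p]ˣ` along the structure morphism. -/
def extendChar {p : ℕ} {F : Type*} [Field F] (R : Type*) [CommRing R] [Algebra (BaseRing p) R]
    (ψ : AddChar F (BaseRing p)) : AddChar F R :=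
  (algebraMap (BaseRing p) R : BaseRing p →* R).compAddChar ψ

/-! ### Subgroups and elements of the general linear groups -/

section Groups

variable {F : Type*} [Field F]

/-- The block matrix with diagonal blocks `A`, `1` and upper right block the column `y`. -/
def blockMatrix {n : ℕ} (A : Matrix (Fin n) (Fin n) F) (y : Fin n → F) :
    Matrix (Fin (n + 1)) (Fin (n + 1)) F :=
  Matrix.reindex finSumFinEquiv finSumFinEquiv
    (Matrix.fromBlocks A (Matrix.of fun i (_ : Fin 1) => y i) 0 1)

theorem blockMatrix_mul {n : ℕ} (A B : Matrix (Fin n) (Fin n) F) (y z : Fin n → F) :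
    blockMatrix A y * blockMatrix B z = blockMatrix (A * B) (A *ᵥ z + y) := by
  simp only [blockMatrix, Matrix.reindex_apply, Matrix.submatrix_mul_equiv,
    Matrix.fromBlocks_multiply]
  congr 1
  simp only [Matrix.mul_zero, Matrix.zero_mul, Matrix.mul_one, add_zero, zero_add]
  congr 1

theorem blockMatrix_one {n : ℕ} : blockMatrix (1 : Matrix (Fin n) (Fin n) F) 0 = 1 := by
  have h : (Matrix.of fun (i : Fin n) (_ : Fin 1) => (0 : Fin n → F) i) = 0 := rfl
  rw [blockMatrix, h, Matrix.fromBlocks_one, Matrix.reindex_apply, Matrix.submatrix_one_equiv]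

theorem blockMatrix_last {n : ℕ} (A : Matrix (Fin n) (Fin n) F) (y : Fin n → F) :
    blockMatrix A y (Fin.last n) = Pi.single (Fin.last n) 1 := by
  have hl : finSumFinEquiv.symm (Fin.last n) = Sum.inr (0 : Fin 1) := by
    rw [Equiv.symm_apply_eq]; rfl
  funext j
  refine Fin.lastCases ?_ (fun i => ?_) j
  · simp [blockMatrix, hl]
  · have hi : finSumFinEquiv.symm i.castSucc = Sum.inl i := by
      rw [Equiv.symm_apply_eq]; rfl
    simp [blockMatrix, hl, hi, Fin.ext_iff, i.isLt.ne]

/-- The element `(g y; 0 1)` of `GL_{n+1}(F)`. -/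
def blockGL {n : ℕ} (g : GL (Fin n) F) (y : Fin n → F) : GL (Fin (n + 1)) F where
  val := blockMatrix g.val y
  inv := blockMatrix g.inv (-(g.inv *ᵥ y))
  val_inv := by
    rw [blockMatrix_mul, g.val_inv, Matrix.mulVec_neg, Matrix.mulVec_mulVec, g.val_inv,
      Matrix.one_mulVec, neg_add_cancel, blockMatrix_one]
  inv_val := by
    rw [blockMatrix_mul, g.inv_val, add_neg_cancel, blockMatrix_one]

theorem blockGL_mul {n : ℕ} (g h : GL (Fin n) F) (y z : Fin n → F) :
    blockGL g y * blockGL h z = blockGL (g * h) (g.val *ᵥ z + y) :=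
  Units.ext (blockMatrix_mul _ _ _ _)

variable (F)

/-- `mirabolic F n` is the mirabolic subgroup `P_{n+1}` of `GL_{n+1}(F)`: the matrices with
bottom row `(0, …, 0, 1)`. -/
def mirabolic (n : ℕ) : Subgroup (GL (Fin (n + 1)) F) where
  carrier := {g | g.val (Fin.last n) = Pi.single (Fin.last n) 1}
  one_mem' := by
    funext j
    simp [Matrix.one_apply, Pi.single_apply, eq_comm]
  mul_mem' {a b} ha hb := by
    have ha' : a.val (Fin.last n) = Pi.single (Fin.last n) 1 := ha
    have hb' : b.val (Fin.last n) = Pi.single (Fin.last n) 1 := hb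
    have h : (a * b).val (Fin.last n) = a.val (Fin.last n) ᵥ* b.val := rfl
    show (a * b).val (Fin.last n) = _
    rw [h, ha', Matrix.single_one_vecMul]
    exact hb'
  inv_mem' {a} ha := by
    have ha' : a.val (Fin.last n) = Pi.single (Fin.last n) 1 := ha
    show (a⁻¹).val (Fin.last n) = _
    have h : (a * a⁻¹).val (Fin.last n) = a.val (Fin.last n) ᵥ* (a⁻¹).val := rfl
    rw [ha', Matrix.single_one_vecMul] at h
    refine h.symm.trans ?_
    rw [mul_inv_cancel]
    funext j
    simp [Matrix.one_apply, Pi.single_apply, eq_comm]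

variable {F}

/-- The element `(1 y; 0 1)` of the unipotent radical `U_{n+1}` of `P_{n+1}`. -/
def unip {n : ℕ} (y : Fin n → F) : mirabolic F n :=
  ⟨blockGL 1 y, blockMatrix_last _ _⟩

variable (F)

/-- The embedding `g ↦ (g 0; 0 1)` of `GL_n(F)` into `P_{n+1}`. -/
def levi (n : ℕ) : GL (Fin n) F →* mirabolic F n where
  toFun g := ⟨blockGL g 0, blockMatrix_last _ _⟩
  map_one' := Subtype.ext (Units.ext blockMatrix_one)
  map_mul' g h := Subtype.ext (by
    show blockGL (g * h) 0 = blockGL g 0 * blockGL h 0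
    rw [blockGL_mul, Matrix.mulVec_zero, add_zero])

variable {F}

theorem levi_mul_unip {n : ℕ} (g : GL (Fin n) F) (y : Fin n → F) :
    levi F n g * unip y = unip (g.val *ᵥ y) * levi F n g := Subtype.ext (by
  show blockGL g 0 * blockGL 1 y = blockGL 1 (g.val *ᵥ y) * blockGL g 0
  rw [blockGL_mul, blockGL_mul]
  simp)

variable (F)

/-- The subgroup `N_n` of unipotent upper triangular matrices. -/
def unipotent [Finite F] (n : ℕ) : Subgroup (GL (Fin n) F) :=
  let M : Submonoid (GL (Fin n) F) :=
    { carrier := {g | (∀ i j, j < i → g.val i j = 0) ∧ ∀ i, g.val i i = 1}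
      one_mem' := ⟨fun i j h => Matrix.one_apply_ne h.ne', fun i => Matrix.one_apply_eq i⟩
      mul_mem' := by
        rintro a b ⟨ha, ha'⟩ ⟨hb, hb'⟩
        refine ⟨fun i j hij => ?_, fun i => ?_⟩
        · show ∑ k, a.val i k * b.val k j = 0
          refine Finset.sum_eq_zero fun k _ => ?_
          rcases lt_or_ge k i with h | h
          · rw [ha i k h, zero_mul]
          · rw [hb k j (hij.trans_le h), mul_zero]
        · show ∑ k, a.val i k * b.val k i = 1
          rw [Finset.sum_eq_single i, ha' i, hb' i, mul_one]
          · intro k _ hk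
            rcases lt_or_gt_of_ne hk with h | h
            · rw [ha i k h, zero_mul]
            · rw [hb k i h, mul_zero]
          · simp }
  { M with
    inv_mem' := by
      intro g hg
      have hfin : IsOfFinOrder g := isOfFinOrder_of_finite g
      have h : g⁻¹ = g ^ (orderOf g - 1) := by
        rw [inv_eq_iff_mul_eq_one, ← pow_succ', Nat.sub_add_cancel hfin.orderOf_pos,
          pow_orderOf_eq_one]
      rw [h]
      exact M.pow_mem hg _ }

variable {F}

/-- The sum of the entries just above the diagonal. -/
def superdiagonalSum {n : ℕ} (g : GL (Fin n) F) : F :=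
  ∑ i : Fin n, ∑ j : Fin n, if i.val + 1 = j.val then g.val i j else 0

/-- Every matrix in `N_{n+1}` is `(1 y; 0 1) (u 0; 0 1)` with `u` in `N_n`. -/
theorem unipotent_decomp [Finite F] {n : ℕ} (g : GL (Fin (n + 1)) F)
    (hg : g ∈ unipotent F (n + 1)) :
    ∃ (u : GL (Fin n) F) (y : Fin n → F), u ∈ unipotent F n ∧ g = blockGL u y := by
  obtain ⟨h0, h1⟩ : (∀ i j, j < i → g.val i j = 0) ∧ ∀ i, g.val i i = 1 := hg
  set A : Matrix (Fin n) (Fin n) F := g.val.submatrix Fin.castSucc Fin.castSucc with hA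
  have hdet : A.det = 1 := by
    have hup : A.IsUpperTriangular := fun i j hij => h0 _ _ (by simpa using hij)
    rw [Matrix.det_of_isUpperTriangular hup]
    exact Finset.prod_eq_one fun i _ => h1 _
  refine ⟨Matrix.GeneralLinearGroup.mkOfDetNeZero A (by rw [hdet]; exact one_ne_zero),
    fun i => g.val i.castSucc (Fin.last n), ⟨fun i j hij => h0 _ _ (by simpa using hij),
    fun i => h1 _⟩, Units.ext ?_⟩
  have hl : finSumFinEquiv.symm (Fin.last n) = Sum.inr (0 : Fin 1) := by
    rw [Equiv.symm_apply_eq]; rfl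
  have hi (i : Fin n) : finSumFinEquiv.symm i.castSucc = Sum.inl i := by
    rw [Equiv.symm_apply_eq]; rfl
  show g.val = blockMatrix A _
  ext i j
  refine Fin.lastCases ?_ (fun i => ?_) i <;> refine Fin.lastCases ?_ (fun j => ?_) j
  · simp [blockMatrix, hl, h1]
  · simp [blockMatrix, hl, hi, h0 _ _ (Fin.castSucc_lt_last j)]
  · simp [blockMatrix, hl, hi]
  · simp [blockMatrix, hi, hA]

theorem superdiagonalSum_blockGL {n : ℕ} (u : GL (Fin (n + 1)) F) (y : Fin (n + 1) → F) :
    superdiagonalSum (blockGL u y) = y (Fin.last n) + superdiagonalSum u := by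
  have hl : finSumFinEquiv.symm (Fin.last (n + 1)) = Sum.inr (0 : Fin 1) := by
    rw [Equiv.symm_apply_eq]; rfl
  have hi (i : Fin (n + 1)) : finSumFinEquiv.symm i.castSucc = Sum.inl i := by
    rw [Equiv.symm_apply_eq]; rfl
  have hE (i j : Fin (n + 1)) :
      (blockGL u y).val i.castSucc j.castSucc = u.val i j := by
    simp [blockGL, blockMatrix, hi]
  have hY (i : Fin (n + 1)) : (blockGL u y).val i.castSucc (Fin.last (n + 1)) = y i := by
    simp [blockGL, blockMatrix, hi, hl]
  simp only [superdiagonalSum]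
  rw [Fin.sum_univ_castSucc]
  have hz : ∑ j : Fin (n + 1 + 1), (if (Fin.last (n + 1)).val + 1 = j.val then
      (blockGL u y).val (Fin.last (n + 1)) j else 0) = 0 :=
    Finset.sum_eq_zero fun j _ => if_neg (by have := j.isLt; simp; omega)
  rw [hz, add_zero]
  simp only [Fin.sum_univ_castSucc (n := n + 1), hE, hY, Finset.sum_add_distrib,
    Fin.val_castSucc, Fin.val_last]
  rw [add_comm]
  congr 1
  rw [Finset.sum_eq_single (Fin.last n)]
  · simp
  · intro i _ hne
    refine if_neg fun h => hne (Fin.ext ?_)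
    simpa using h
  · simp

/-- The involution `g ↦ ᵗg⁻¹`. -/
def transposeInv {n : ℕ} (g : GL (Fin n) F) : GL (Fin n) F where
  val := (g⁻¹).valᵀ
  inv := g.valᵀ
  val_inv := by rw [← Matrix.transpose_mul, ← Units.val_mul, mul_inv_cancel]; simp
  inv_val := by rw [← Matrix.transpose_mul, ← Units.val_mul, inv_mul_cancel]; simp

variable (F)

/-- The matrix `w_n` with ones on the antidiagonal and zeros elsewhere. -/
def antidiagonalMatrix (n : ℕ) : Matrix (Fin n) (Fin n) F :=
  Matrix.of fun i j => if j = Fin.rev i then 1 else 0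

theorem antidiagonalMatrix_mul_self (n : ℕ) :
    antidiagonalMatrix F n * antidiagonalMatrix F n = 1 := by
  ext i j
  rw [Matrix.mul_apply, Finset.sum_eq_single (Fin.rev i)]
  · simp [antidiagonalMatrix, Matrix.one_apply, eq_comm]
  · intro k _ hk
    simp [antidiagonalMatrix, hk]
  · simp

/-- `w_n` as an element of `GL_n(F)`. -/
def longWeyl (n : ℕ) : GL (Fin n) F where
  val := antidiagonalMatrix F n
  inv := antidiagonalMatrix F n
  val_inv := antidiagonalMatrix_mul_self F n
  inv_val := antidiagonalMatrix_mul_self F n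

/-- The row vector `η = (0, …, 0, 1)`. -/
def eta (n : ℕ) : Fin n → F := fun i => if i.val + 1 = n then 1 else 0

end Groups

/-! ### Invariant multilinear forms -/

section Forms

variable {R G : Type*} [CommRing R] [Group G] {V V' V'' : Type*} [AddCommGroup V] [Module R V]
  [AddCommGroup V'] [Module R V'] [AddCommGroup V''] [Module R V'']

/-- The `R`-module `Bil_G(V, V', 1)` of `G`-invariant bilinear forms. -/
def bilinearForms (ρ : Representation R G V) (ρ' : Representation R G V') :
    Submodule R (V →ₗ[R] V' →ₗ[R] R) where
  carrier := {B | ∀ g v v', B (ρ g v) (ρ' g v') = B v v'}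
  zero_mem' := fun _ _ _ => rfl
  add_mem' ha hb := fun g v v' => by simp [ha g v v', hb g v v']
  smul_mem' c _ ha := fun g v v' => by simp [ha g v v']

/-- The `R`-module `Tril_G(V, V', V'')` of `G`-invariant trilinear forms. -/
def trilinearForms (ρ : Representation R G V) (ρ' : Representation R G V')
    (ρ'' : Representation R G V'') : Submodule R (V →ₗ[R] V' →ₗ[R] V'' →ₗ[R] R) where
  carrier := {B | ∀ g v v' v'', B (ρ g v) (ρ' g v') (ρ'' g v'') = B v v' v''}
  zero_mem' := fun _ _ _ _ => rfl
  add_mem' ha hb := fun g v v' v'' => by simp [ha g v v' v'', hb g v v' v'']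
  smul_mem' c _ ha := fun g v v' v'' => by simp [ha g v v' v'']

end Forms

/-! ### Bernstein-Zelevinsky derivatives -/

section Derivatives

universe w

variable {F : Type*} [Field F] {R : Type*} [CommRing R]

/-- The submodule `V(U_{n+1}, χ)` spanned by all `u v - χ(u) v` with `u` in `U_{n+1}`, where
`U_{n+1}` is identified with `F^n`. -/
def unipRelations {n : ℕ} (V : Rep.{w} R (mirabolic F n)) (χ : (Fin n → F) → R) :
    Submodule R V :=
  Submodule.span R {x | ∃ (y : Fin n → F) (v : V), x = V.ρ (unip y) v - χ y • v}

/-- An element of `GL_n(F)` that stabilizes `χ` acts on the `(U_{n+1}, χ)`-coinvariants. -/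
theorem unipRelations_le_comap {n : ℕ} (V : Rep.{w} R (mirabolic F n)) (χ : (Fin n → F) → R)
    (g : GL (Fin n) F) (hg : ∀ y, χ (g.val *ᵥ y) = χ y) :
    unipRelations V χ ≤ (unipRelations V χ).comap (V.ρ (levi F n g)) := by
  refine Submodule.span_le.2 ?_
  rintro _ ⟨y, v, rfl⟩
  refine Submodule.subset_span ⟨g.val *ᵥ y, V.ρ (levi F n g) v, ?_⟩
  rw [map_sub, map_smul, hg, ← Module.End.mul_apply, ← Module.End.mul_apply, ← map_mul,
    ← map_mul, levi_mul_unip]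

/-- The functor `Ψ⁻` from representations of `P_{n+1}` to representations of `GL_n(F)`:
the coinvariants of `U_{n+1}`. -/
def psiMinus {n : ℕ} (V : Rep.{w} R (mirabolic F n)) : Rep.{w} R (GL (Fin n) F) :=
  Rep.of (Representation.quotient (V.ρ.comp (levi F n)) (unipRelations V fun _ => 1)
    fun g => unipRelations_le_comap V _ g fun _ => rfl)

/-- The functor `Φ⁻` from representations of `P_{n+2}` to representations of `P_{n+1}`:
the `(U_{n+2}, ψ)`-coinvariants, where `ψ (1 y; 0 1) = ψ(y_{n+1})` for `y` in `F^{n+1}`. -/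
def phiMinus (ψ : AddChar F R) {n : ℕ} (V : Rep.{w} R (mirabolic F (n + 1))) :
    Rep.{w} R (mirabolic F n) :=
  Rep.of (Representation.quotient (V.ρ.comp ((levi F (n + 1)).comp (mirabolic F n).subtype))
    (unipRelations V fun y => ψ (y (Fin.last n)))
    fun g => unipRelations_le_comap V _ g.1 fun y => by
      have h : (g.1.val *ᵥ y) (Fin.last n) = g.1.val (Fin.last n) ⬝ᵥ y := rfl
      have hg : g.1.val (Fin.last n) = Pi.single (Fin.last n) 1 := g.2
      rw [h, hg, single_one_dotProduct])

/-- For a representation `V` of `P_{t+k+1}`, the derivative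
`V^{(k+1)} = Ψ⁻ (Φ⁻)^k V`, a representation of `GL_t(F)`. -/
def mirabolicDerivative (ψ : AddChar F R) (t : ℕ) :
    (k : ℕ) → Rep.{w} R (mirabolic F (t + k)) → Rep.{w} R (GL (Fin t) F)
  | 0, V => psiMinus V
  | k + 1, V => mirabolicDerivative ψ t k (phiMinus ψ V)

/-- The quotient map `V → V^{(k+1)}` for a representation `V` of `P_{t+k+1}`. -/
def mirabolicDerivativeProj (ψ : AddChar F R) (t : ℕ) :
    (k : ℕ) → (V : Rep.{w} R (mirabolic F (t + k))) → V →ₗ[R] mirabolicDerivative ψ t k V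
  | 0, V => (unipRelations V fun _ => 1).mkQ
  | k + 1, V => (mirabolicDerivativeProj ψ t k (phiMinus ψ V)).comp
      (unipRelations V fun y => ψ (y (Fin.last (t + k)))).mkQ

/-- The restriction of a representation of `GL_{n+1}(F)` to `P_{n+1}`. -/
def restrictMirabolic {n : ℕ} (V : Rep.{w} R (GL (Fin (n + 1)) F)) : Rep.{w} R (mirabolic F n) :=
  Rep.of (V.ρ.comp (mirabolic F n).subtype)

/-- The `k`-th derivative `V^{(k)}` (with respect to `ψ`) of a representation `V` of `GL_n(F)`,
where `n = t + k`; it is a representation of `GL_t(F)`, and `V^{(0)} = V`. -/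
def derivative (ψ : AddChar F R) {n : ℕ} (t : ℕ) :
    (k : ℕ) → t + k = n → Rep.{w} R (GL (Fin n) F) → Rep.{w} R (GL (Fin t) F)
  | 0, rfl, V => V
  | k + 1, rfl, V => mirabolicDerivative ψ t k (restrictMirabolic V)

/-- The quotient map `V → V^{(k)}`. -/
def derivativeProj (ψ : AddChar F R) {n : ℕ} (t : ℕ) :
    (k : ℕ) → (h : t + k = n) → (V : Rep.{w} R (GL (Fin n) F)) → V →ₗ[R] derivative ψ t k h V
  | 0, rfl, _ => LinearMap.id
  | k + 1, rfl, V => mirabolicDerivativeProj ψ t k (restrictMirabolic V)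

theorem mirabolicDerivativeProj_unipotent [Finite F] (ψ : AddChar F R) :
    ∀ (t k : ℕ) (_ : t = 0) (V : Rep.{w} R (mirabolic F (t + k))) (u : mirabolic F (t + k))
      (_ : u.val ∈ unipotent F (t + k + 1)) (v : V),
      mirabolicDerivativeProj ψ t k V (V.ρ u v) =
        ψ (superdiagonalSum u.val) • mirabolicDerivativeProj ψ t k V v
  | t, 0, ht, V, u, hu, v => by
    subst ht
    have h1 : u.val = 1 := by
      refine Units.ext (Matrix.ext fun i j => ?_)
      obtain rfl : i = j := Subsingleton.elim (α := Fin 1) i j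
      exact (hu.2 i).trans (Matrix.one_apply_eq i).symm
    obtain rfl : u = 1 := Subtype.ext h1
    have h0 : superdiagonalSum (1 : GL (Fin (0 + 0 + 1)) F) = 0 := by
      refine Finset.sum_eq_zero fun i _ => Finset.sum_eq_zero fun j _ => if_neg ?_
      have := j.isLt
      omega
    have h : superdiagonalSum (1 : mirabolic F (0 + 0)).val = 0 := h0
    rw [h]
    simp
  | t, k + 1, ht, V, u, hu, v => by
    obtain ⟨u', y, hu', huy⟩ := unipotent_decomp u.val hu
    have hrow : u'.val (Fin.last (t + k)) = Pi.single (Fin.last (t + k)) 1 := by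
      funext j
      rcases eq_or_ne j (Fin.last (t + k)) with rfl | hj
      · simpa using hu'.2 _
      · rw [Pi.single_eq_of_ne hj]
        exact hu'.1 _ _ (Fin.lt_last_iff_ne_last.2 hj)
    have hu2 : u = unip y * levi F (t + (k + 1)) u' := Subtype.ext (by
      rw [huy]
      show _ = blockGL 1 y * blockGL u' 0
      rw [blockGL_mul]
      simp)
    have ih := mirabolicDerivativeProj_unipotent ψ t k ht (phiMinus ψ V) ⟨u', hrow⟩ hu'
      ((unipRelations V fun y => ψ (y (Fin.last (t + k)))).mkQ v)
    have hs : superdiagonalSum u.val = y (Fin.last (t + k)) + superdiagonalSum u' := by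
      rw [huy]; exact superdiagonalSum_blockGL u' y
    rw [hs, AddChar.map_add_eq_mul, mul_smul]
    refine Eq.trans ?_ (congrArg (ψ (y (Fin.last (t + k))) • ·) ih)
    have hq : (unipRelations V fun y => ψ (y (Fin.last (t + k)))).mkQ (V.ρ u v) =
        ψ (y (Fin.last (t + k))) • (phiMinus ψ V).ρ ⟨u', hrow⟩
          ((unipRelations V fun y => ψ (y (Fin.last (t + k)))).mkQ v) := by
      refine (Submodule.Quotient.eq _).2 (Submodule.subset_span
        ⟨y, V.ρ (levi F (t + (k + 1)) u') v, ?_⟩)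
      rw [hu2, map_mul]
      rfl
    show mirabolicDerivativeProj ψ t k (phiMinus ψ V) _ = _
    exact (congrArg _ hq).trans (map_smul _ _ _)

theorem derivativeProj_unipotent [Finite F] (ψ : AddChar F R) :
    ∀ {n : ℕ} (t k : ℕ) (_ : t = 0) (h : t + k = n) (V : Rep.{w} R (GL (Fin n) F))
      (u : GL (Fin n) F) (_ : u ∈ unipotent F n) (v : V),
      derivativeProj ψ t k h V (V.ρ u v) = ψ (superdiagonalSum u) • derivativeProj ψ t k h V v
  | _, t, 0, ht, rfl, V, u, hu, v => by
    subst ht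
    have h : u = 1 := Units.ext (Matrix.ext fun i _ => (Fin.isEmpty.false i).elim)
    subst h
    have h0 : superdiagonalSum (1 : GL (Fin 0) F) = 0 := rfl
    show V.ρ 1 v = ψ (superdiagonalSum (1 : GL (Fin 0) F)) • v
    rw [h0]
    simp
  | _, t, k + 1, ht, rfl, V, u, hu, v => by
    have hrow : u.val (Fin.last (t + k)) = Pi.single (Fin.last (t + k)) 1 := by
      funext j
      rcases eq_or_ne j (Fin.last (t + k)) with rfl | hj
      · simpa using hu.2 _
      · rw [Pi.single_eq_of_ne hj]
        exact hu.1 _ _ (Fin.lt_last_iff_ne_last.2 hj)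
    exact mirabolicDerivativeProj_unipotent ψ t k ht (restrictMirabolic V) ⟨u, hrow⟩ hu v

/-- The top derivative `V^{(n)}` of a representation of `GL_n(F)`. -/
abbrev topDerivative (ψ : AddChar F R) {n : ℕ} (V : Rep.{w} R (GL (Fin n) F)) :
    Rep.{w} R (GL (Fin 0) F) :=
  derivative ψ 0 n (zero_add n) V

end Derivatives

/-! ### Whittaker models -/

section Whittaker

universe w w'

variable {F : Type*} [Field F] {R : Type*} [CommRing R]

/-- `V` is of `ψ`-Whittaker type: its top derivative is free of rank one over `R`. -/
def IsWhittakerType (ψ : AddChar F R) {n : ℕ} (V : Rep.{w} R (GL (Fin n) F)) : Prop :=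
  Nonempty (Module.Basis Unit R (topDerivative ψ V))

/-- The Whittaker space `𝒲(ψ) = Ind_{N_n}^{GL_n(F)} ψ`, where `ψ(u)` is the value of `ψ` at the
sum of the superdiagonal entries of `u`. -/
def whittakerSpace [Finite F] (ψ : AddChar F R) (n : ℕ) : Submodule R (GL (Fin n) F → R) where
  carrier := {W | ∀ u ∈ unipotent F n, ∀ g, W (u * g) = ψ (superdiagonalSum u) * W g}
  zero_mem' := fun _ _ _ => by simp
  add_mem' ha hb := fun u hu g => by simp [ha u hu g, hb u hu g, mul_add]
  smul_mem' c _ ha := fun u hu g => by simp [ha u hu g, mul_left_comm]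

/-- The map `v ↦ W_v`, `W_v(g) = l (g v)`, attached to a linear form `l` on `V^{(n)}`. -/
def whittakerMap (ψ : AddChar F R) {n : ℕ} (V : Rep.{w} R (GL (Fin n) F))
    (l : topDerivative ψ V →ₗ[R] R) : V →ₗ[R] (GL (Fin n) F → R) :=
  LinearMap.pi fun g => l.comp ((derivativeProj ψ 0 n (zero_add n) V).comp (V.ρ g))

/-- The `ψ`-Whittaker model `𝒲(V, ψ)`. The supremum runs over all linear forms on `V^{(n)}`; when
these are generated by one form `l`, it is the image of the single map `v ↦ W_v` attached to `l`,
by `whittakerModel_eq_range`. -/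
def whittakerModel (ψ : AddChar F R) {n : ℕ} (V : Rep.{w} R (GL (Fin n) F)) :
    Submodule R (GL (Fin n) F → R) :=
  ⨆ l : topDerivative ψ V →ₗ[R] R, LinearMap.range (whittakerMap ψ V l)

theorem whittakerModel_eq_range (ψ : AddChar F R) {n : ℕ} (V : Rep.{w} R (GL (Fin n) F))
    (l : topDerivative ψ V →ₗ[R] R) (hl : Submodule.span R {l} = ⊤) :
    whittakerModel ψ V = LinearMap.range (whittakerMap ψ V l) := by
  refine le_antisymm (iSup_le fun l' => ?_) (le_iSup_of_le l le_rfl)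
  obtain ⟨c, rfl⟩ := Submodule.mem_span_singleton.1 (hl ▸ Submodule.mem_top : l' ∈ _)
  rintro _ ⟨v, rfl⟩
  exact ⟨c • v, by ext g; simp [whittakerMap]⟩

/-- The Whittaker model is a submodule of the Whittaker space. -/
theorem whittakerModel_le_whittakerSpace [Finite F] (ψ : AddChar F R) {n : ℕ}
    (V : Rep.{w} R (GL (Fin n) F)) : whittakerModel ψ V ≤ whittakerSpace ψ n := by
  refine iSup_le fun l => ?_
  rintro _ ⟨v, rfl⟩ u hu g
  simp only [whittakerMap, LinearMap.pi_apply, LinearMap.comp_apply]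
  rw [map_mul, Module.End.mul_apply, derivativeProj_unipotent ψ 0 n rfl _ V u hu, map_smul,
    smul_eq_mul]

variable (R F) in
/-- The right translation action `(g · W)(x) = W(x g)` on functions on `GL_n(F)`. -/
def rightTranslation (n : ℕ) : Representation R (GL (Fin n) F) (GL (Fin n) F → R) where
  toFun g := LinearMap.funLeft R R fun x => x * g
  map_one' := by ext; simp [LinearMap.funLeft]
  map_mul' g h := by ext; simp [LinearMap.funLeft, mul_assoc]

theorem whittakerModel_le_comap (ψ : AddChar F R) {n : ℕ} (V : Rep.{w} R (GL (Fin n) F))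
    (g : GL (Fin n) F) :
    whittakerModel ψ V ≤ (whittakerModel ψ V).comap (rightTranslation F R n g) := by
  refine iSup_le fun l => ?_
  rintro _ ⟨v, rfl⟩
  refine (le_iSup (fun l => LinearMap.range (whittakerMap ψ V l)) l) ⟨V.ρ g v, ?_⟩
  funext x
  simp [whittakerMap, rightTranslation, LinearMap.funLeft]

/-- The Whittaker model `𝒲(V, ψ)` as a representation of `GL_n(F)`. -/
def whittakerRep (ψ : AddChar F R) {n : ℕ} (V : Rep.{w} R (GL (Fin n) F)) :
    Rep R (GL (Fin n) F) :=
  Rep.of ((rightTranslation F R n).subrepresentation (whittakerModel ψ V)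
    (whittakerModel_le_comap ψ V))

/-- `(V, V')` is an exceptional pair: there is `1 ≤ t ≤ min m n` with
`Bil_{GL_t(F)}(𝒲(V, ψ)^{(n-t)}, 𝒲(V', ψ⁻¹)^{(m-t)}, 1) ≠ 0`. Here `n = t + k`, `m = t + k'`. -/
def IsExceptionalPair (ψ : AddChar F R) {n m : ℕ} (V : Rep.{w} R (GL (Fin n) F))
    (V' : Rep.{w'} R (GL (Fin m) F)) : Prop :=
  ∃ (t k k' : ℕ) (h : t + k = n) (h' : t + k' = m), 1 ≤ t ∧
    bilinearForms (derivative ψ t k h (whittakerRep ψ V)).ρ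
      (derivative ψ⁻¹ t k' h' (whittakerRep ψ⁻¹ V')).ρ ≠ ⊥

end Whittaker

/-! ### The functional equation for `n = m` -/

section FunctionalEquation

variable (F : Type*) [Field F] (R : Type*) [CommRing R]

/-- The representation of `GL_n(F)` on the functions `F^n → R`, by `(g · f)(x) = f(x g)`. -/
def functionRep (n : ℕ) : Representation R (GL (Fin n) F) ((Fin n → F) → R) where
  toFun g := LinearMap.funLeft R R fun x => x ᵥ* g.val
  map_one' := by ext; simp [LinearMap.funLeft]
  map_mul' g h := by ext; simp [LinearMap.funLeft, Matrix.vecMul_vecMul]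

variable {F R}

/-- `I(W, W', Φ) = ∑_{g ∈ N_n \ GL_n(F)} W(g) W'(g) Φ(η g)`. The summand is evaluated at a
representative of each coset; it does not depend on it when `W` and `W'` are Whittaker functions
for mutually inverse characters. -/
def zetaSum [Finite F] {n : ℕ} (W W' : GL (Fin n) F → R) (Φ : (Fin n → F) → R) : R :=
  ∑ᶠ x : Quotient (QuotientGroup.rightRel (unipotent F n)),
    W x.out * W' x.out * Φ (eta F n ᵥ* x.out.val)

/-- `W̃(g) = W(w_n ᵗg⁻¹)`. -/
def tilde {n : ℕ} (W : GL (Fin n) F → R) : GL (Fin n) F → R :=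
  fun g => W (longWeyl F n * transposeInv g)

/-- The Fourier transform `Φ̂(a) = ∑_x Φ(x) ψ(a · x)`. -/
def finiteFourier [Fintype F] (ψ : AddChar F R) {n : ℕ} (Φ : (Fin n → F) → R) : (Fin n → F) → R :=
  fun a => ∑ x : Fin n → F, Φ x * ψ (a ⬝ᵥ x)

end FunctionalEquation

end

end FiniteWhittaker

open FiniteWhittaker

/-!
Since `p` is invertible in the coefficient ring and a nontrivial additive character of `F` sums to
zero, every representation of an abelian group `F^n` is the direct sum of its eigenspaces, and
coinvariants of `U_n` or `N_n` for a character are the same as vectors on which the group acts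
through that character. All constructions are therefore carried out with averaging operators. In
particular `V^{(n)}` is identified with the Whittaker vectors of `V`
(`derivativeProj_bijective`), and the diagonal element with alternating signs shows that being of
Whittaker type does not depend on replacing `ψ` by `ψ⁻¹` (`IsWhittakerType.inv`).

A trilinear form `T` is determined by the bilinear forms `T(·, ·, δ_x)`. The one for `x = 0` is
`GL_n(F)`-invariant, so it vanishes because the pair is not exceptional. Those for `x ≠ 0` are
translates of the one for `x = η`, which is invariant under the mirabolic subgroup `P_n`.
By induction along the functors `Ψ⁻` and `Φ⁻`, a `P_n`-invariant form on `𝒲 × 𝒲'` is determined by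
its values on Whittaker vectors (`eq_zero_of_forall_equivariants`): the only other contributions are
forms on the derivatives of positive rank, which vanish by hypothesis. The Whittaker vectors of a
Whittaker model are free of rank one, with their value at `1` as coordinate
(`eq_zero_of_mem_whittakerModel`). So `T` is determined by the single value
`T(W₀, W₀', δ_η)`, where `W₀` and `W₀'` are the Whittaker vectors with value `1` at `1`
(`trilinearForm_eq_zero`).

On `P_n` the function `W₀` is supported on `N_n`
(`eq_zero_of_mem_mirabolic_of_notMem_unipotent`), whence `I(W₀, W₀', δ_η) = 1`
(`zetaSum_single_eta`). Therefore `I` generates the invariant forms. The form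
`(W, W', Φ) ↦ I(W̃, W̃', Φ̂)` is invariant as well, hence of the form `γ I`. The spaces of functions
`W̃` and `W̃'` consist of Whittaker functions for `ψ⁻¹` and `ψ`, are stable under right translation
and contain functions with value `1` at `1`; moreover `δ_η` is a Fourier transform. So the same
computation shows that `γ I` takes the value `1`, and `γ` is a unit.
-/

namespace FiniteWhittaker

/-! ### Matrix groups -/

section MatrixGroups

variable {F : Type*} [Field F]

theorem blockGL_castSucc_castSucc {n : ℕ} (g : GL (Fin n) F) (y : Fin n → F) (i j : Fin n) :
    (blockGL g y).val i.castSucc j.castSucc = g.val i j := by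
  have hi (i : Fin n) : finSumFinEquiv.symm i.castSucc = Sum.inl i := by
    rw [Equiv.symm_apply_eq]; rfl
  simp [blockGL, blockMatrix, hi]

theorem blockGL_castSucc_last {n : ℕ} (g : GL (Fin n) F) (y : Fin n → F) (i : Fin n) :
    (blockGL g y).val i.castSucc (Fin.last n) = y i := by
  have hl : finSumFinEquiv.symm (Fin.last n) = Sum.inr (0 : Fin 1) := by
    rw [Equiv.symm_apply_eq]; rfl
  have hi (i : Fin n) : finSumFinEquiv.symm i.castSucc = Sum.inl i := by
    rw [Equiv.symm_apply_eq]; rfl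
  simp [blockGL, blockMatrix, hi, hl]

theorem blockGL_last {n : ℕ} (g : GL (Fin n) F) (y : Fin n → F) :
    (blockGL g y).val (Fin.last n) = Pi.single (Fin.last n) 1 :=
  blockMatrix_last _ _

theorem blockGL_injective {n : ℕ} {g h : GL (Fin n) F} {y z : Fin n → F}
    (H : blockGL g y = blockGL h z) : g = h ∧ y = z := by
  refine ⟨Units.ext (Matrix.ext fun i j => ?_), funext fun i => ?_⟩
  · rw [← blockGL_castSucc_castSucc g y, H, blockGL_castSucc_castSucc]
  · rw [← blockGL_castSucc_last g y, H, blockGL_castSucc_last]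

theorem blockGL_eq_unip_mul_levi {n : ℕ} (g : GL (Fin n) F) (y : Fin n → F) :
    blockGL g y = (unip y * levi F n g).val := by
  show _ = blockGL 1 y * blockGL g 0
  rw [blockGL_mul]
  simp

/-- Every element of the mirabolic subgroup `P_{n+1}` is `(g y; 0 1)` with `g` in `GL_n(F)`. -/
theorem exists_eq_blockGL_of_mem_mirabolic {n : ℕ} {g : GL (Fin (n + 1)) F}
    (hg : g ∈ mirabolic F n) : ∃ (h : GL (Fin n) F) (y : Fin n → F), g = blockGL h y := by
  have key (k : GL (Fin (n + 1)) F) (hk : k ∈ mirabolic F n) :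
      k.val = blockMatrix (k.val.submatrix Fin.castSucc Fin.castSucc)
        (fun i => k.val i.castSucc (Fin.last n)) := by
    have hk' : k.val (Fin.last n) = Pi.single (Fin.last n) 1 := hk
    have hl : finSumFinEquiv.symm (Fin.last n) = Sum.inr (0 : Fin 1) := by
      rw [Equiv.symm_apply_eq]; rfl
    have hi (i : Fin n) : finSumFinEquiv.symm i.castSucc = Sum.inl i := by
      rw [Equiv.symm_apply_eq]; rfl
    ext i j
    refine Fin.lastCases ?_ (fun i => ?_) i
    · rw [hk', blockMatrix_last]
    · refine Fin.lastCases ?_ (fun j => ?_) j <;> simp [blockMatrix, hl, hi]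
  have hmul (k l : GL (Fin (n + 1)) F) (hk : k ∈ mirabolic F n) (hl : l ∈ mirabolic F n)
      (hkl : k * l = 1) : k.val.submatrix Fin.castSucc Fin.castSucc *
        l.val.submatrix Fin.castSucc Fin.castSucc = 1 := by
    have h : k.val * l.val = 1 := by rw [← Units.val_mul, hkl]; rfl
    rw [key k hk, key l hl, blockMatrix_mul] at h
    have h' := congrArg (fun M : Matrix (Fin (n + 1)) (Fin (n + 1)) F =>
      M.submatrix Fin.castSucc Fin.castSucc) h
    have hi (i : Fin n) : finSumFinEquiv.symm i.castSucc = Sum.inl i := by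
      rw [Equiv.symm_apply_eq]; rfl
    ext i j
    have h'' := congrFun (congrFun h' i) j
    simpa [blockMatrix, hi, Matrix.one_apply] using h''
  refine ⟨⟨g.val.submatrix Fin.castSucc Fin.castSucc, (g⁻¹).val.submatrix Fin.castSucc
    Fin.castSucc, hmul _ _ hg (inv_mem hg) (mul_inv_cancel g),
    hmul _ _ (inv_mem hg) hg (inv_mul_cancel g)⟩, fun i => g.val i.castSucc (Fin.last n),
    Units.ext (key g hg)⟩

variable (F) in
/-- The embedding `y ↦ (1 y; 0 1)` of the additive group `F^n` into the mirabolic subgroup. -/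
def unipHom (n : ℕ) : Multiplicative (Fin n → F) →* mirabolic F n where
  toFun y := unip y.toAdd
  map_one' := Subtype.ext (Units.ext blockMatrix_one)
  map_mul' y z := Subtype.ext (by
    show blockGL 1 (y.toAdd + z.toAdd) = blockGL 1 y.toAdd * blockGL 1 z.toAdd
    rw [blockGL_mul, one_mul]
    simp [add_comm])

theorem eta_succ (n : ℕ) : eta F (n + 1) = Pi.single (Fin.last n) 1 := by
  funext j
  simp [eta, Pi.single_apply, Fin.ext_iff]

theorem mem_mirabolic_iff {n : ℕ} {g : GL (Fin (n + 1)) F} :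
    g ∈ mirabolic F n ↔ eta F (n + 1) ᵥ* g.val = eta F (n + 1) := by
  rw [eta_succ, Matrix.single_one_vecMul]
  rfl

/-- `GL_{n+1}(F)` acts transitively on nonzero row vectors. -/
theorem exists_eta_vecMul_eq {n : ℕ} {a : Fin (n + 1) → F} (ha : a ≠ 0) :
    ∃ g : GL (Fin (n + 1)) F, eta F (n + 1) ᵥ* g.val = a := by
  obtain ⟨j, hj⟩ := Function.ne_iff.1 ha
  have hdet : ((1 : Matrix (Fin (n + 1)) (Fin (n + 1)) F).updateRow j a).det = a j := by
    have h := Matrix.cramer_transpose_apply (1 : Matrix (Fin (n + 1)) (Fin (n + 1)) F) a j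
    rw [← h]
    simp
  -- The identity with row `j` replaced by `a`, and rows `j` and `n + 1` swapped.
  set M := ((1 : Matrix (Fin (n + 1)) (Fin (n + 1)) F).updateRow j a).submatrix
    (Equiv.swap j (Fin.last n)) id with hM
  have hMdet : M.det ≠ 0 := by
    rw [hM, Matrix.det_permute, hdet]
    refine mul_ne_zero ?_ hj
    rcases Int.units_eq_one_or (Equiv.Perm.sign (Equiv.swap j (Fin.last n))) with h | h <;>
      simp [h]
  refine ⟨Matrix.GeneralLinearGroup.mkOfDetNeZero M hMdet, ?_⟩
  rw [eta_succ, Matrix.single_one_vecMul]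
  funext k
  show M (Fin.last n) k = a k
  simp [hM]

theorem eta_dotProduct {n : ℕ} (y : Fin (n + 1) → F) : eta F (n + 1) ⬝ᵥ y = y (Fin.last n) := by
  rw [eta_succ, single_one_dotProduct]

section Finite

variable [Finite F]

theorem mem_unipotent {n : ℕ} {g : GL (Fin n) F} :
    g ∈ unipotent F n ↔ (∀ i j, j < i → g.val i j = 0) ∧ ∀ i, g.val i i = 1 :=
  Iff.rfl

theorem unipotent_le_mirabolic (n : ℕ) : unipotent F (n + 1) ≤ mirabolic F n := by
  intro u hu
  show u.val (Fin.last n) = _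
  funext j
  rcases eq_or_ne j (Fin.last n) with rfl | hj
  · simpa using hu.2 _
  · rw [Pi.single_eq_of_ne hj]
    exact hu.1 _ _ (Fin.lt_last_iff_ne_last.2 hj)

theorem blockGL_mem_unipotent {n : ℕ} {u : GL (Fin n) F} (hu : u ∈ unipotent F n)
    (y : Fin n → F) : blockGL u y ∈ unipotent F (n + 1) := by
  refine ⟨fun i j hij => ?_, fun i => ?_⟩
  · refine Fin.lastCases (fun hij => ?_) (fun i hij => ?_) i hij
    · rw [blockGL_last, Pi.single_eq_of_ne hij.ne]
    · obtain ⟨j, rfl⟩ := Fin.exists_castSucc_eq.2 (hij.trans (Fin.castSucc_lt_last i)).ne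
      rw [blockGL_castSucc_castSucc]
      exact hu.1 _ _ (by simpa using hij)
  · refine Fin.lastCases ?_ (fun i => ?_) i
    · rw [blockGL_last, Pi.single_eq_same]
    · rw [blockGL_castSucc_castSucc]
      exact hu.2 i

theorem superdiagonalSum_mul {n : ℕ} {u v : GL (Fin n) F} (hu : u ∈ unipotent F n)
    (hv : v ∈ unipotent F n) :
    superdiagonalSum (u * v) = superdiagonalSum u + superdiagonalSum v := by
  simp only [superdiagonalSum, ← Finset.sum_add_distrib]
  refine Finset.sum_congr rfl fun i _ => Finset.sum_congr rfl fun j _ => ?_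
  split_ifs with hij
  · have hne : i ≠ j := fun h => by rw [h] at hij; omega
    show ∑ k, u.val i k * v.val k j = _
    -- Only the indices `k = i` and `k = j` lie between `i` and `j = i + 1`.
    rw [Fintype.sum_eq_add i j hne, hu.2, hv.2, one_mul, mul_one, add_comm]
    rintro k ⟨hki, hkj⟩
    rcases lt_or_gt_of_ne hki with h | h
    · rw [hu.1 i k h, zero_mul]
    · rw [hv.1 k j, mul_zero]
      rw [Fin.lt_def] at h ⊢
      have := Fin.val_ne_of_ne hkj
      omega
  · simp

variable (F) in
/-- The homomorphism `N_n → F` given by the sum of the superdiagonal entries. -/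
def superdiagonalHom (n : ℕ) : unipotent F n →* Multiplicative F :=
  MonoidHom.mk' (fun u => Multiplicative.ofAdd (superdiagonalSum u.val)) fun u v =>
    congrArg Multiplicative.ofAdd (superdiagonalSum_mul u.2 v.2)

theorem superdiagonalSum_one (n : ℕ) : superdiagonalSum (1 : GL (Fin n) F) = 0 :=
  congrArg Multiplicative.toAdd (map_one (superdiagonalHom F n))

theorem superdiagonalSum_inv {n : ℕ} {u : GL (Fin n) F} (hu : u ∈ unipotent F n) :
    superdiagonalSum u⁻¹ = -superdiagonalSum u :=
  congrArg Multiplicative.toAdd (map_inv (superdiagonalHom F n) ⟨u, hu⟩)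

theorem superdiagonalSum_unip {n : ℕ} (y : Fin (n + 1) → F) :
    superdiagonalSum (unip y).val = y (Fin.last n) := by
  rw [show (unip y).val = blockGL 1 y from rfl, superdiagonalSum_blockGL, superdiagonalSum_one,
    add_zero]

theorem unip_mem_unipotent {n : ℕ} (y : Fin n → F) : (unip y).val ∈ unipotent F (n + 1) :=
  blockGL_mem_unipotent (one_mem _) y

theorem card_unipotent_succ (n : ℕ) :
    Nat.card (unipotent F (n + 1)) = Nat.card F ^ n * Nat.card (unipotent F n) := by
  have e : (Fin n → F) × unipotent F n ≃ unipotent F (n + 1) :=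
    Equiv.ofBijective (fun x => ⟨blockGL x.2.val x.1, blockGL_mem_unipotent x.2.2 x.1⟩) (by
      constructor
      · rintro ⟨y, u⟩ ⟨z, v⟩ h
        obtain ⟨h1, h2⟩ := blockGL_injective (congrArg Subtype.val h)
        exact Prod.ext h2 (Subtype.ext h1)
      · rintro ⟨g, hg⟩
        obtain ⟨u, y, hu, rfl⟩ := unipotent_decomp g hg
        exact ⟨(y, ⟨u, hu⟩), rfl⟩)
  rw [← Nat.card_congr e, Nat.card_prod, Nat.card_fun, Nat.card_eq_fintype_card (α := Fin n),
    Fintype.card_fin]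

theorem isUnit_card_unipotent {R : Type*} [CommRing R] (hq : IsUnit (Nat.card F : R)) (n : ℕ) :
    IsUnit (Nat.card (unipotent F n) : R) := by
  induction n with
  | zero =>
    have : Subsingleton (GL (Fin 0) F) :=
      ⟨fun a b => Units.ext (Matrix.ext fun i _ => (Fin.isEmpty.false i).elim)⟩
    simp
  | succ n ih =>
    rw [card_unipotent_succ, Nat.cast_mul, Nat.cast_pow]
    exact (hq.pow n).mul ih

end Finite

/-- The element `diag(1, -1, 1, …)` of `GL_n(F)`. -/
def alternatingDiagonal (F : Type*) [Field F] (n : ℕ) : GL (Fin n) F where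
  val := Matrix.diagonal fun i => (-1) ^ i.val
  inv := Matrix.diagonal fun i => (-1) ^ i.val
  val_inv := by simp [Matrix.diagonal_mul_diagonal, ← mul_pow]
  inv_val := by simp [Matrix.diagonal_mul_diagonal, ← mul_pow]

theorem alternatingDiagonal_conj_apply {n : ℕ} (g : GL (Fin n) F) (i j : Fin n) :
    (alternatingDiagonal F n * g * alternatingDiagonal F n).val i j =
      (-1) ^ (i.val + j.val) * g.val i j := by
  show (Matrix.diagonal (fun i : Fin n => (-1 : F) ^ i.val) * g.val *
    Matrix.diagonal (fun i : Fin n => (-1 : F) ^ i.val)) i j = _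
  rw [Matrix.mul_diagonal, Matrix.diagonal_mul, pow_add]
  ring

theorem alternatingDiagonal_mul_self (n : ℕ) :
    alternatingDiagonal F n * alternatingDiagonal F n = 1 :=
  Units.ext (alternatingDiagonal F n).val_inv

theorem alternatingDiagonal_conj_mem_unipotent [Finite F] {n : ℕ} {u : GL (Fin n) F}
    (hu : u ∈ unipotent F n) :
    alternatingDiagonal F n * u * alternatingDiagonal F n ∈ unipotent F n := by
  refine ⟨fun i j hij => ?_, fun i => ?_⟩
  · rw [alternatingDiagonal_conj_apply, hu.1 i j hij, mul_zero]
  · rw [alternatingDiagonal_conj_apply, hu.2, mul_one, Even.neg_one_pow ⟨_, rfl⟩]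

theorem superdiagonalSum_alternatingDiagonal_conj {n : ℕ} (u : GL (Fin n) F) :
    superdiagonalSum (alternatingDiagonal F n * u * alternatingDiagonal F n) =
      -superdiagonalSum u := by
  simp only [superdiagonalSum, ← Finset.sum_neg_distrib]
  refine Finset.sum_congr rfl fun i _ => Finset.sum_congr rfl fun j _ => ?_
  split_ifs with h
  · rw [alternatingDiagonal_conj_apply, ← h, Odd.neg_one_pow ⟨i.val, by ring⟩, neg_one_mul]
  · simp

theorem transposeInv_mul {n : ℕ} (g h : GL (Fin n) F) :
    transposeInv (g * h) = transposeInv g * transposeInv h := by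
  refine Units.ext ?_
  show ((g * h)⁻¹).valᵀ = (g⁻¹).valᵀ * (h⁻¹).valᵀ
  rw [_root_.mul_inv_rev, Units.val_mul, Matrix.transpose_mul]

theorem transposeInv_transposeInv {n : ℕ} (g : GL (Fin n) F) :
    transposeInv (transposeInv g) = g := by
  refine Units.ext ?_
  show (g.valᵀ)ᵀ = g.val
  rw [Matrix.transpose_transpose]

theorem longWeyl_mul_self (n : ℕ) : longWeyl F n * longWeyl F n = 1 :=
  Units.ext (antidiagonalMatrix_mul_self F n)

/-- Conjugation by `w_n` reflects matrices in both directions. -/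
theorem longWeyl_conj_apply {n : ℕ} (g : GL (Fin n) F) (i j : Fin n) :
    (longWeyl F n * g * longWeyl F n).val i j = g.val (Fin.rev i) (Fin.rev j) := by
  show (antidiagonalMatrix F n * g.val * antidiagonalMatrix F n) i j = _
  rw [Matrix.mul_apply, Finset.sum_eq_single (Fin.rev j)]
  · rw [Matrix.mul_apply, Finset.sum_eq_single (Fin.rev i)]
    · simp [antidiagonalMatrix]
    · intro k _ hk
      simp [antidiagonalMatrix, hk]
    · simp
  · intro k _ hk
    have : j ≠ Fin.rev k := fun h => hk (by rw [h, Fin.rev_rev])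
    simp [antidiagonalMatrix, this]
  · simp

theorem longWeyl_conj_transposeInv_apply {n : ℕ} (g : GL (Fin n) F) (i j : Fin n) :
    (longWeyl F n * transposeInv g * longWeyl F n).val i j =
      (g⁻¹).val (Fin.rev j) (Fin.rev i) :=
  longWeyl_conj_apply _ i j

theorem longWeyl_conj_transposeInv_mem_unipotent [Finite F] {n : ℕ} {u : GL (Fin n) F}
    (hu : u ∈ unipotent F n) :
    longWeyl F n * transposeInv u * longWeyl F n ∈ unipotent F n := by
  have hu' := mem_unipotent.1 (inv_mem hu)
  refine ⟨fun i j hij => ?_, fun i => ?_⟩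
  · rw [longWeyl_conj_transposeInv_apply]
    exact hu'.1 _ _ (Fin.rev_lt_rev.2 hij)
  · rw [longWeyl_conj_transposeInv_apply]
    exact hu'.2 _

theorem superdiagonalSum_longWeyl_conj_transposeInv [Finite F] {n : ℕ} {u : GL (Fin n) F}
    (hu : u ∈ unipotent F n) :
    superdiagonalSum (longWeyl F n * transposeInv u * longWeyl F n) = -superdiagonalSum u := by
  rw [← superdiagonalSum_inv hu, superdiagonalSum, superdiagonalSum, Finset.sum_comm]
  refine Fintype.sum_equiv Fin.revPerm _ _ fun j => Fintype.sum_equiv Fin.revPerm _ _ fun i => ?_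
  rw [longWeyl_conj_transposeInv_apply]
  have hi := i.isLt
  have hj := j.isLt
  simp only [Fin.revPerm_apply, Fin.val_rev]
  exact if_congr (by omega) rfl rfl

end MatrixGroups

/-! ### Equivariant vectors and averaging over finite groups -/

section Averaging

variable {R H V : Type*} [CommRing R] [Group H] [AddCommGroup V] [Module R V]

/-- The vectors on which `H` acts through the character `c`. -/
def equivariants (σ : Representation R H V) (c : H →* R) : Submodule R V where
  carrier := {x | ∀ h, σ h x = c h • x}
  zero_mem' := fun _ => by simp
  add_mem' hx hy := fun h => by rw [map_add, hx h, hy h, smul_add]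
  smul_mem' r _ hx := fun h => by rw [map_smul, hx h, smul_comm]

/-- The operator `∑_h c(h)⁻¹ h`, which is `|H|` times the projection onto the vectors on which `H`
acts through `c` when `|H|` is invertible. -/
noncomputable def average [Finite H] (σ : Representation R H V) (c : H →* R) : V →ₗ[R] V :=
  letI := Fintype.ofFinite H
  ∑ h : H, c h⁻¹ • σ h

theorem average_apply [Fintype H] (σ : Representation R H V) (c : H →* R) (x : V) :
    average σ c x = ∑ h : H, c h⁻¹ • σ h x := by
  have h : average σ c = ∑ h : H, c h⁻¹ • σ h := by
    unfold average
    congr!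
  rw [h]
  simp

theorem char_inv_mul_self (c : H →* R) (h : H) : c h⁻¹ * c h = 1 := by
  rw [← map_mul, inv_mul_cancel, map_one]

variable [Finite H]

theorem average_apply_rep (σ : Representation R H V) (c : H →* R) (h : H) (x : V) :
    average σ c (σ h x) = c h • average σ c x := by
  have := Fintype.ofFinite H
  rw [average_apply, average_apply, Finset.smul_sum]
  refine Fintype.sum_equiv (Equiv.mulRight h) _ _ fun k => ?_
  rw [Equiv.coe_mulRight, map_mul, Module.End.mul_apply, smul_smul, ← map_mul, _root_.mul_inv_rev,
    mul_inv_cancel_left]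

theorem rep_average_apply (σ : Representation R H V) (c : H →* R) (h : H) (x : V) :
    σ h (average σ c x) = c h • average σ c x := by
  have := Fintype.ofFinite H
  rw [average_apply, map_sum, Finset.smul_sum]
  refine Fintype.sum_equiv (Equiv.mulLeft h) _ _ fun k => ?_
  rw [Equiv.coe_mulLeft, map_mul, Module.End.mul_apply, smul_smul, mul_comm, ← map_mul,
    _root_.mul_inv_rev, inv_mul_cancel_right, map_smul]

theorem average_mem_equivariants (σ : Representation R H V) (c : H →* R) (x : V) :
    average σ c x ∈ equivariants σ c :=
  fun h => rep_average_apply σ c h x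

theorem average_of_mem_equivariants {σ : Representation R H V} {c : H →* R} {x : V}
    (hx : x ∈ equivariants σ c) : average σ c x = (Nat.card H : R) • x := by
  have := Fintype.ofFinite H
  rw [average_apply, Finset.sum_congr rfl fun h _ => by
    rw [hx h, smul_smul, char_inv_mul_self, one_smul]]
  rw [Finset.sum_const, Finset.card_univ, Nat.card_eq_fintype_card, Nat.cast_smul_eq_nsmul]

theorem map_average {V' : Type*} [AddCommGroup V'] [Module R V'] {σ : Representation R H V}
    {c : H →* R} (f : V →ₗ[R] V') (hf : ∀ h x, f (σ h x) = c h • f x) (x : V) :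
    f (average σ c x) = (Nat.card H : R) • f x := by
  have := Fintype.ofFinite H
  rw [average_apply, map_sum, Finset.sum_congr rfl fun h _ => by
    rw [map_smul, hf, smul_smul, char_inv_mul_self, one_smul]]
  rw [Finset.sum_const, Finset.card_univ, Nat.card_eq_fintype_card, Nat.cast_smul_eq_nsmul]

end Averaging

/-! ### Characters of `N_n` and of `U_{n+1}` -/

section Characters

variable {F : Type*} [Field F] {R : Type*} [CommRing R]

/-- The character `u ↦ χ(∑ u_{i,i+1})` of `N_n`. -/
def whittakerChar [Finite F] (χ : AddChar F R) (n : ℕ) : unipotent F n →* R :=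
  χ.toMonoidHom.comp (superdiagonalHom F n)

/-- The character `(1 y; 0 1) ↦ χ(a · y)` of `U_{n+1}`, on the additive group `F^n`. -/
def unipChar (χ : AddChar F R) {n : ℕ} (a : Fin n → F) : Multiplicative (Fin n → F) →* R where
  toFun y := χ (a ⬝ᵥ y.toAdd)
  map_one' := by rw [toAdd_one, dotProduct_zero, AddChar.map_zero_eq_one]
  map_mul' y z := by rw [toAdd_mul, dotProduct_add, AddChar.map_add_eq_mul]

theorem sum_addChar_dotProduct [Fintype F] {χ : AddChar F R} (hχ : ∑ x, χ x = 0) {n : ℕ}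
    {a : Fin n → F} (ha : a ≠ 0) : ∑ y : Fin n → F, χ (a ⬝ᵥ y) = 0 := by
  obtain ⟨j, hj⟩ := Function.ne_iff.1 ha
  have h (y : Fin n → F) : χ (a ⬝ᵥ y) = ∏ i, χ (a i * y i) :=
    map_prod χ.toMonoidHom (fun i => Multiplicative.ofAdd (a i * y i)) Finset.univ
  rw [Finset.sum_congr rfl fun y _ => h y, ← Fintype.piFinset_univ,
    ← Finset.prod_univ_sum (fun _ => Finset.univ) fun i t => χ (a i * t)]
  refine Finset.prod_eq_zero (Finset.mem_univ j) ?_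
  rw [← hχ]
  exact Fintype.sum_equiv (Equiv.mulLeft₀ (a j) hj) _ _ fun _ => rfl

theorem sum_addChar_dotProduct_eq_ite [Fintype F] [DecidableEq F] {χ : AddChar F R}
    (hχ : ∑ x, χ x = 0) {n : ℕ} (a : Fin n → F) :
    ∑ y : Fin n → F, χ (a ⬝ᵥ y) = if a = 0 then (Nat.card F : R) ^ n else 0 := by
  split_ifs with ha
  · subst ha
    simp
  · exact sum_addChar_dotProduct hχ ha

theorem sum_inv_eq_zero [Fintype F] {χ : AddChar F R} (hχ : ∑ x, χ x = 0) :
    ∑ x, χ⁻¹ x = 0 := by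
  rw [← hχ]
  exact Fintype.sum_equiv (Equiv.neg F) _ _ fun x => AddChar.inv_apply χ x

variable [Fintype F]

/-- The averaging operator over `U_{n+1}` for the character `(1 y; 0 1) ↦ χ(a · y)`. -/
noncomputable def unipAverage {n : ℕ} (X : Rep R (mirabolic F n)) (χ : AddChar F R)
    (a : Fin n → F) : X →ₗ[R] X :=
  average (X.ρ.comp (unipHom F n)) (unipChar χ a)

variable {n : ℕ} (X : Rep R (mirabolic F n)) (χ : AddChar F R)

theorem unipAverage_apply (a : Fin n → F) (x : X) :
    unipAverage X χ a x = ∑ y : Fin n → F, χ (-(a ⬝ᵥ y)) • X.ρ (unip y) x := by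
  rw [unipAverage, average_apply]
  refine Fintype.sum_equiv Multiplicative.toAdd _ _ fun y => ?_
  rw [← dotProduct_neg]
  rfl

theorem rep_unip_unipAverage (a y : Fin n → F) (x : X) :
    X.ρ (unip y) (unipAverage X χ a x) = χ (a ⬝ᵥ y) • unipAverage X χ a x :=
  rep_average_apply (X.ρ.comp (unipHom F n)) (unipChar χ a) (Multiplicative.ofAdd y) x

theorem unipRelations_le_ker_unipAverage {k : (Fin n → F) → R} {a : Fin n → F}
    (hk : ∀ y, k y = χ (a ⬝ᵥ y)) : unipRelations X k ≤ LinearMap.ker (unipAverage X χ a) := by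
  refine Submodule.span_le.2 ?_
  rintro _ ⟨y, v, rfl⟩
  rw [SetLike.mem_coe, LinearMap.mem_ker, map_sub, map_smul, hk, sub_eq_zero]
  exact average_apply_rep (X.ρ.comp (unipHom F n)) (unipChar χ a) (Multiplicative.ofAdd y) v

theorem unipAverage_rep_levi (g : GL (Fin n) F) (a : Fin n → F) (x : X) :
    unipAverage X χ a (X.ρ (levi F n g) x) =
      X.ρ (levi F n g) (unipAverage X χ (a ᵥ* g.val) x) := by
  rw [unipAverage_apply, unipAverage_apply, map_sum]
  have hinv : g.val * g⁻¹.val = 1 := by rw [← Units.val_mul, mul_inv_cancel]; rfl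
  have hinv' : g⁻¹.val * g.val = 1 := by rw [← Units.val_mul, inv_mul_cancel]; rfl
  refine Fintype.sum_equiv ⟨fun y => g⁻¹.val *ᵥ y, fun y => g.val *ᵥ y, fun y => ?_, fun y => ?_⟩
    _ _ fun y => ?_
  · show g.val *ᵥ g⁻¹.val *ᵥ y = y
    rw [Matrix.mulVec_mulVec, hinv, Matrix.one_mulVec]
  · show g⁻¹.val *ᵥ g.val *ᵥ y = y
    rw [Matrix.mulVec_mulVec, hinv', Matrix.one_mulVec]
  · rw [Equiv.coe_fn_mk, map_smul, ← Matrix.dotProduct_mulVec, Matrix.mulVec_mulVec, hinv,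
      Matrix.one_mulVec, ← Module.End.mul_apply, ← Module.End.mul_apply, ← map_mul, ← map_mul,
      levi_mul_unip, Matrix.mulVec_mulVec, hinv, Matrix.one_mulVec]

/-- The decomposition of a representation under the characters of `U_{n+1}`. -/
theorem sum_unipAverage {χ : AddChar F R} (hχ : ∑ x, χ x = 0) (x : X) :
    ∑ a, unipAverage X χ a x = (Nat.card F : R) ^ n • x := by
  classical
  simp only [unipAverage_apply]
  rw [Finset.sum_comm]
  have h (y : Fin n → F) : ∑ a : Fin n → F, χ (-(a ⬝ᵥ y)) • X.ρ (unip y) x =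
      if y = 0 then (Nat.card F : R) ^ n • x else 0 := by
    have h1 : ∑ a : Fin n → F, χ (-(a ⬝ᵥ y)) = if y = 0 then (Nat.card F : R) ^ n else 0 := by
      rw [← if_congr (neg_eq_zero (a := y)) rfl rfl, ← sum_addChar_dotProduct_eq_ite hχ]
      refine Finset.sum_congr rfl fun a _ => ?_
      rw [neg_dotProduct, dotProduct_comm]
    rw [← Finset.sum_smul, h1]
    split_ifs with hy
    · have h2 : (unip y : mirabolic F n) = 1 := by
        subst hy
        exact map_one (unipHom F n)
      rw [h2, map_one, Module.End.one_apply]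
    · rw [zero_smul]
  rw [Finset.sum_congr rfl fun y _ => h y]
  simp

theorem unipAverage_of_forall {a : Fin n → F} {x : X}
    (hx : ∀ y, X.ρ (unip y) x = χ (a ⬝ᵥ y) • x) :
    unipAverage X χ a x = (Nat.card F : R) ^ n • x := by
  have h := average_of_mem_equivariants (σ := X.ρ.comp (unipHom F n)) (c := unipChar χ a)
    (x := x) fun y => hx y.toAdd
  rw [unipAverage, h, Nat.card_congr (Multiplicative.toAdd (α := Fin n → F)), Nat.card_fun]
  simp

end Characters

/-! ### Whittaker vectors in representations of the mirabolic group -/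

section MirabolicWhittaker

variable {F : Type*} [Field F] {R : Type*} [CommRing R]

/-- The vectors in a representation of `P_{n+1}` on which `N_{n+1}` acts through `χ`. -/
def mirabolicEquivariants [Finite F] (χ : AddChar F R) {n : ℕ} (X : Rep R (mirabolic F n)) :
    Submodule R X :=
  equivariants (X.ρ.comp (Subgroup.inclusion (unipotent_le_mirabolic n)))
    (whittakerChar χ (n + 1))

theorem mem_mirabolicEquivariants [Finite F] {χ : AddChar F R} {n : ℕ}
    {X : Rep R (mirabolic F n)} {x : X} : x ∈ mirabolicEquivariants χ X ↔
      ∀ u : mirabolic F n, u.val ∈ unipotent F (n + 1) →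
        X.ρ u x = χ (superdiagonalSum u.val) • x :=
  ⟨fun h u hu => h ⟨u.val, hu⟩, fun h u => h _ u.2⟩

theorem levi_mem_unipotent [Finite F] {n : ℕ} {u : GL (Fin n) F} (hu : u ∈ unipotent F n) :
    (levi F n u).val ∈ unipotent F (n + 1) :=
  blockGL_mem_unipotent hu 0

theorem superdiagonalSum_levi {n : ℕ} (u : GL (Fin (n + 1)) F) :
    superdiagonalSum (levi F (n + 1) u).val = superdiagonalSum u := by
  rw [show (levi F (n + 1) u).val = blockGL u 0 from rfl, superdiagonalSum_blockGL, Pi.zero_apply,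
    zero_add]

/-- The quotient map `X → Φ⁻X`. -/
abbrev phiMinusMk (χ : AddChar F R) {n : ℕ} (X : Rep R (mirabolic F (n + 1))) :
    X →ₗ[R] phiMinus χ X :=
  (unipRelations X fun y => χ (y (Fin.last n))).mkQ

theorem phiMinusMk_surjective (χ : AddChar F R) {n : ℕ} (X : Rep R (mirabolic F (n + 1))) :
    Function.Surjective (phiMinusMk χ X) :=
  Submodule.mkQ_surjective _

theorem phiMinus_rep_mk (χ : AddChar F R) {n : ℕ} (X : Rep R (mirabolic F (n + 1)))
    (g : mirabolic F n) (x : X) :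
    (phiMinus χ X).ρ g (phiMinusMk χ X x) = phiMinusMk χ X (X.ρ (levi F (n + 1) g.val) x) :=
  rfl

theorem phiMinusMk_mem_equivariants [Finite F] {χ : AddChar F R} {n : ℕ}
    {X : Rep R (mirabolic F (n + 1))} {x : X} (hx : x ∈ mirabolicEquivariants χ X) :
    phiMinusMk χ X x ∈ mirabolicEquivariants χ (phiMinus χ X) := by
  rw [mem_mirabolicEquivariants] at hx ⊢
  intro u hu
  rw [phiMinus_rep_mk, hx _ (levi_mem_unipotent hu), map_smul, superdiagonalSum_levi]

theorem mirabolicDerivativeProj_surjective (χ : AddChar F R) :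
    ∀ (t k : ℕ) (X : Rep R (mirabolic F (t + k))),
      Function.Surjective (mirabolicDerivativeProj χ t k X)
  | _, 0, _ => Submodule.mkQ_surjective _
  | t, k + 1, X => (mirabolicDerivativeProj_surjective χ t k (phiMinus χ X)).comp
      (phiMinusMk_surjective χ X)

variable [Fintype F]

theorem unipAverage_eta_eq_zero {χ : AddChar F R} {n : ℕ} {X : Rep R (mirabolic F (n + 1))}
    {x : X} (hx : phiMinusMk χ X x = 0) : unipAverage X χ (eta F (n + 1)) x = 0 :=
  unipRelations_le_ker_unipAverage X χ (fun y => by rw [eta_dotProduct])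
    ((Submodule.Quotient.mk_eq_zero _).1 hx)

/-- Averaging over `U_{n+2}` lifts Whittaker vectors from `Φ⁻X` to `X`. -/
theorem unipAverage_eta_mem_equivariants {χ : AddChar F R} {n : ℕ}
    {X : Rep R (mirabolic F (n + 1))} {x : X}
    (hx : phiMinusMk χ X x ∈ mirabolicEquivariants χ (phiMinus χ X)) :
    unipAverage X χ (eta F (n + 1)) x ∈ mirabolicEquivariants χ X := by
  rw [mem_mirabolicEquivariants] at hx ⊢
  intro u hu
  obtain ⟨u', y, hu', huy⟩ := unipotent_decomp u.val hu
  have hu'm : u' ∈ mirabolic F n := unipotent_le_mirabolic n hu'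
  have hu2 : u = unip y * levi F (n + 1) u' :=
    Subtype.ext (huy.trans (blockGL_eq_unip_mul_levi u' y))
  have hl : X.ρ (levi F (n + 1) u') (unipAverage X χ (eta F (n + 1)) x) =
      χ (superdiagonalSum u') • unipAverage X χ (eta F (n + 1)) x := by
    have h1 := unipAverage_rep_levi X χ u' (eta F (n + 1)) x
    rw [mem_mirabolic_iff.1 hu'm] at h1
    rw [← h1, ← map_smul, ← sub_eq_zero, ← map_sub]
    refine unipAverage_eta_eq_zero ?_
    rw [map_sub, map_smul, sub_eq_zero]
    exact hx ⟨u', hu'm⟩ hu'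
  rw [huy, superdiagonalSum_blockGL, hu2, map_mul, Module.End.mul_apply, hl, map_smul,
    rep_unip_unipAverage, smul_smul, AddChar.map_add_eq_mul, eta_dotProduct, mul_comm]

theorem unipAverage_eta_of_mem_equivariants {χ : AddChar F R} {n : ℕ}
    {X : Rep R (mirabolic F (n + 1))} {x : X} (hx : x ∈ mirabolicEquivariants χ X) :
    unipAverage X χ (eta F (n + 1)) x = (Nat.card F : R) ^ (n + 1) • x := by
  refine unipAverage_of_forall X χ fun y => ?_
  rw [mem_mirabolicEquivariants.1 hx _ (unip_mem_unipotent y), superdiagonalSum_unip,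
    eta_dotProduct]

theorem mirabolicDerivativeProj_injOn (hq : IsUnit (Nat.card F : R)) (χ : AddChar F R) :
    ∀ (t k : ℕ) (_ : t = 0) (X : Rep R (mirabolic F (t + k))) (x : X),
      x ∈ mirabolicEquivariants χ X → mirabolicDerivativeProj χ t k X x = 0 → x = 0
  | t, 0, ht, X, x, _, h => by
    subst ht
    -- `U_1` is trivial, so that no relations are imposed.
    have hrel : unipRelations X (fun _ => 1) = ⊥ := by
      refine Submodule.span_eq_bot.2 ?_
      rintro _ ⟨y, v, rfl⟩
      have h1 : (unip y : mirabolic F 0) = 1 := by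
        rw [Subsingleton.elim y 0]
        exact map_one (unipHom F 0)
      erw [h1]
      simp
    have h2 : x ∈ unipRelations X (fun _ => 1) := (Submodule.Quotient.mk_eq_zero _).1 h
    rwa [hrel, Submodule.mem_bot] at h2
  | t, k + 1, ht, X, x, hx, h => by
    have h1 : phiMinusMk χ X x = 0 := mirabolicDerivativeProj_injOn hq χ t k ht (phiMinus χ X) _
      (phiMinusMk_mem_equivariants hx) h
    have h2 := unipAverage_eta_of_mem_equivariants hx
    rw [unipAverage_eta_eq_zero h1] at h2
    exact (hq.pow _).smul_eq_zero.1 h2.symm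

end MirabolicWhittaker

/-! ### Whittaker vectors and the top derivative -/

section TopDerivative

variable {F : Type*} [Field F] {R : Type*} [CommRing R]

theorem derivativeProj_surjective (χ : AddChar F R) :
    ∀ {n : ℕ} (t k : ℕ) (h : t + k = n) (V : Rep R (GL (Fin n) F)),
      Function.Surjective (derivativeProj χ t k h V)
  | _, _, 0, rfl, _ => Function.surjective_id
  | _, t, k + 1, rfl, V => mirabolicDerivativeProj_surjective χ t k (restrictMirabolic V)

/-- The vectors in a representation of `GL_n(F)` on which `N_n` acts through `χ`. -/
def whittakerVectors [Finite F] (χ : AddChar F R) {n : ℕ} (V : Rep R (GL (Fin n) F)) :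
    Submodule R V :=
  equivariants (V.ρ.comp (unipotent F n).subtype) (whittakerChar χ n)

theorem mem_whittakerVectors [Finite F] {χ : AddChar F R} {n : ℕ} {V : Rep R (GL (Fin n) F)}
    {x : V} : x ∈ whittakerVectors χ V ↔
      ∀ u ∈ unipotent F n, V.ρ u x = χ (superdiagonalSum u) • x :=
  ⟨fun h u hu => h ⟨u, hu⟩, fun h u => h _ u.2⟩

theorem derivativeProj_injOn [Fintype F] (hq : IsUnit (Nat.card F : R)) (χ : AddChar F R) :
    ∀ {n : ℕ} (t k : ℕ) (_ : t = 0) (h : t + k = n) (V : Rep R (GL (Fin n) F)) (x : V),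
      x ∈ whittakerVectors χ V → derivativeProj χ t k h V x = 0 → x = 0
  | _, _, 0, _, rfl, _, _, _, h => h
  | _, t, k + 1, ht, rfl, V, x, hx, h => by
    refine mirabolicDerivativeProj_injOn hq χ t k ht (restrictMirabolic V) x ?_ h
    exact mem_mirabolicEquivariants.2 fun u hu => mem_whittakerVectors.1 hx u.val hu

/-- The quotient map `V → V^{(n)}` restricts to an isomorphism from the Whittaker vectors of `V`
to `V^{(n)}`: since `|N_n|` is invertible, coinvariants are the same as invariants. -/
theorem derivativeProj_bijective [Fintype F] (hq : IsUnit (Nat.card F : R)) (χ : AddChar F R)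
    {n : ℕ} (V : Rep R (GL (Fin n) F)) :
    Function.Bijective ((derivativeProj χ 0 n (zero_add n) V).domRestrict
      (whittakerVectors χ V)) := by
  constructor
  · rw [← LinearMap.ker_eq_bot, LinearMap.ker_eq_bot']
    rintro ⟨x, hx⟩ h
    exact Subtype.ext (derivativeProj_injOn hq χ 0 n rfl _ V x hx h)
  · intro z
    obtain ⟨v, rfl⟩ := derivativeProj_surjective χ 0 n (zero_add n) V z
    obtain ⟨c, hc⟩ := isUnit_card_unipotent hq n
    refine ⟨(↑c⁻¹ : R) • ⟨average (V.ρ.comp (unipotent F n).subtype) (whittakerChar χ n) v,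
      average_mem_equivariants _ _ v⟩, ?_⟩
    rw [map_smul, LinearMap.domRestrict_apply, map_average (σ := V.ρ.comp (unipotent F n).subtype)
      (c := whittakerChar χ n) (derivativeProj χ 0 n (zero_add n) V) fun u w =>
        derivativeProj_unipotent χ 0 n rfl _ V u.val u.2 w, ← hc, smul_smul, Units.inv_mul,
      one_smul]

/-- The top derivative of `V` is isomorphic to the module of Whittaker vectors of `V`. -/
noncomputable def whittakerVectorsEquiv [Fintype F] (hq : IsUnit (Nat.card F : R))
    (χ : AddChar F R) {n : ℕ} (V : Rep R (GL (Fin n) F)) :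
    whittakerVectors χ V ≃ₗ[R] topDerivative χ V :=
  LinearEquiv.ofBijective _ (derivativeProj_bijective hq χ V)

theorem rep_alternatingDiagonal_mem_whittakerVectors [Finite F] {χ : AddChar F R} {n : ℕ}
    {V : Rep R (GL (Fin n) F)} {x : V} (hx : x ∈ whittakerVectors χ V) :
    V.ρ (alternatingDiagonal F n) x ∈ whittakerVectors χ⁻¹ V := by
  rw [mem_whittakerVectors] at hx ⊢
  intro u hu
  set d := alternatingDiagonal F n with hd
  have h : u * d = d * (d * u * d) := by
    rw [mul_assoc d, ← mul_assoc d, alternatingDiagonal_mul_self, one_mul]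
  rw [← Module.End.mul_apply, ← map_mul, h, map_mul, Module.End.mul_apply,
    hx _ (alternatingDiagonal_conj_mem_unipotent hu), superdiagonalSum_alternatingDiagonal_conj,
    map_smul, AddChar.inv_apply]

theorem rep_alternatingDiagonal_rep [Finite F] {n : ℕ} (V : Rep R (GL (Fin n) F)) (x : V) :
    V.ρ (alternatingDiagonal F n) (V.ρ (alternatingDiagonal F n) x) = x := by
  rw [← Module.End.mul_apply, ← map_mul, alternatingDiagonal_mul_self, map_one,
    Module.End.one_apply]

/-- The element `diag(1, -1, 1, …)` exchanges the Whittaker vectors for `χ` and for `χ⁻¹`. -/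
noncomputable def whittakerVectorsInvEquiv [Finite F] (χ : AddChar F R) {n : ℕ}
    (V : Rep R (GL (Fin n) F)) : whittakerVectors χ V ≃ₗ[R] whittakerVectors χ⁻¹ V :=
  LinearEquiv.ofLinearMap
    (LinearMap.restrict (V.ρ (alternatingDiagonal F n)) fun _ hx =>
      rep_alternatingDiagonal_mem_whittakerVectors hx)
    (LinearMap.restrict (V.ρ (alternatingDiagonal F n)) fun _ hx => by
      simpa using rep_alternatingDiagonal_mem_whittakerVectors hx)
    (LinearMap.ext fun x => Subtype.ext (rep_alternatingDiagonal_rep V x.val))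
    (LinearMap.ext fun x => Subtype.ext (rep_alternatingDiagonal_rep V x.val))

theorem IsWhittakerType.inv [Fintype F] (hq : IsUnit (Nat.card F : R)) {χ : AddChar F R} {n : ℕ}
    {V : Rep R (GL (Fin n) F)} (hV : IsWhittakerType χ V) : IsWhittakerType χ⁻¹ V := by
  obtain ⟨b⟩ := hV
  exact ⟨b.map ((whittakerVectorsEquiv hq χ V).symm ≪≫ₗ whittakerVectorsInvEquiv χ V ≪≫ₗ
    whittakerVectorsEquiv hq χ⁻¹ V)⟩

end TopDerivative

/-! ### Invariant bilinear forms on representations of the mirabolic group -/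

section MirabolicForms

variable {F : Type*} [Field F] {R : Type*} [CommRing R]

section Descent

variable {n : ℕ} {X : Rep R (mirabolic F n)} {Y : Rep R (mirabolic F n)} {χ : AddChar F R}
  {B : X →ₗ[R] Y →ₗ[R] R}

theorem apply_rep_right (hB : B ∈ bilinearForms X.ρ Y.ρ) (g : mirabolic F n) (x : X) (y : Y) :
    B x (Y.ρ g y) = B (X.ρ g⁻¹ x) y := by
  rw [← hB g (X.ρ g⁻¹ x) y, ← Module.End.mul_apply, ← map_mul, mul_inv_cancel, map_one,
    Module.End.one_apply]

variable [Fintype F]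

theorem apply_unipAverage_rep_unip (hB : B ∈ bilinearForms X.ρ Y.ρ) (a : Fin n → F) (x : X)
    (y : Y) (z : Fin n → F) :
    B (unipAverage X χ a x) (Y.ρ (unip z) y) =
      χ⁻¹ (a ⬝ᵥ z) * B (unipAverage X χ a x) y := by
  have h : (unip z : mirabolic F n)⁻¹ = unip (-z) :=
    (map_inv (unipHom F n) (Multiplicative.ofAdd z)).symm
  rw [apply_rep_right hB, h, rep_unip_unipAverage, map_smul, LinearMap.smul_apply, smul_eq_mul,
    dotProduct_neg, AddChar.inv_apply]

theorem apply_unipAverage_unipAverage (hB : B ∈ bilinearForms X.ρ Y.ρ) (a : Fin n → F) (x : X)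
    (y : Y) : B (unipAverage X χ a x) (unipAverage Y χ⁻¹ a y) =
      (Nat.card F : R) ^ n * B (unipAverage X χ a x) y := by
  have h := map_average (σ := Y.ρ.comp (unipHom F n)) (c := unipChar χ⁻¹ a)
    (B (unipAverage X χ a x)) (fun z w => apply_unipAverage_rep_unip hB a x w z.toAdd) y
  refine h.trans ?_
  rw [Nat.card_congr (Multiplicative.toAdd (α := Fin n → F)), Nat.card_fun]
  simp

/-- The form `(x, y) ↦ B(e x, y)` on the coinvariants of `X` and `Y` for opposite characters of
`U_{n+1}`, where `e` is the averaging operator. -/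
noncomputable def descend (hB : B ∈ bilinearForms X.ρ Y.ρ) (χ : AddChar F R) (a : Fin n → F)
    {k k' : (Fin n → F) → R} (hk : ∀ y, k y = χ (a ⬝ᵥ y)) (hk' : ∀ y, k' y = χ⁻¹ (a ⬝ᵥ y)) :
    (X ⧸ unipRelations X k) →ₗ[R] (Y ⧸ unipRelations Y k') →ₗ[R] R :=
  ((unipRelations Y k').liftQ ((unipRelations X k).liftQ (B.comp (unipAverage X χ a))
    ((unipRelations_le_ker_unipAverage X χ hk).trans fun x hx => by
      rw [LinearMap.mem_ker] at hx
      rw [LinearMap.mem_ker, LinearMap.comp_apply, hx, map_zero])).flip (by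
        refine Submodule.span_le.2 ?_
        rintro _ ⟨z, y, rfl⟩
        rw [SetLike.mem_coe, LinearMap.mem_ker]
        ext x
        show B (unipAverage X χ a x) (Y.ρ (unip z) y - k' z • y) = 0
        rw [map_sub, map_smul, apply_unipAverage_rep_unip hB, hk', smul_eq_mul, sub_self])).flip

theorem apply_unipAverage_levi (hB : B ∈ bilinearForms X.ρ Y.ρ) (a : Fin n → F)
    (g : GL (Fin n) F) (x : X) (y : Y) :
    B (unipAverage X χ a (X.ρ (levi F n g) x)) (Y.ρ (levi F n g) y) =
      B (unipAverage X χ (a ᵥ* g.val) x) y := by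
  rw [unipAverage_rep_levi, hB]

end Descent

theorem mem_mirabolicEquivariants_zero [Finite F] (χ : AddChar F R) {X : Rep R (mirabolic F 0)}
    (x : X) : x ∈ mirabolicEquivariants χ X := by
  rw [mem_mirabolicEquivariants]
  intro u hu
  -- `P_1` is trivial.
  have h1 : u = 1 := Subtype.ext (Units.ext (Matrix.ext fun i j => by
    obtain rfl : i = j := Subsingleton.elim (α := Fin 1) i j
    exact (hu.2 i).trans (Matrix.one_apply_eq i).symm))
  subst h1
  rw [map_one, OneMemClass.coe_one, superdiagonalSum_one, AddChar.map_zero_eq_one, one_smul,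
    Module.End.one_apply]

variable [Fintype F]

/-- An invariant form on a pair of representations of `P_{m+1}` whose derivatives of positive rank
admit no invariant forms is determined by its values on Whittaker vectors. The form decomposes
under the characters of `U_{m+1}`: the trivial character gives a form on the `Ψ⁻`, and the
nontrivial ones, which are permuted transitively, give a form on the `Φ⁻`. -/
theorem eq_zero_of_forall_equivariants (hq : IsUnit (Nat.card F : R)) {χ : AddChar F R}
    (hχ : ∑ x, χ x = 0) : ∀ (m : ℕ) (X : Rep R (mirabolic F m)) (Y : Rep R (mirabolic F m))
      (_ : ∀ (t k : ℕ) (h : m = t + k), 1 ≤ t →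
        bilinearForms (mirabolicDerivative χ t k (h ▸ X)).ρ
          (mirabolicDerivative χ⁻¹ t k (h ▸ Y)).ρ = ⊥)
      (B : X →ₗ[R] Y →ₗ[R] R) (_ : B ∈ bilinearForms X.ρ Y.ρ)
      (_ : ∀ x ∈ mirabolicEquivariants χ X, ∀ y ∈ mirabolicEquivariants χ⁻¹ Y, B x y = 0),
      B = 0
  | 0, X, Y, _, B, _, h => by
    ext x y
    exact h x (mem_mirabolicEquivariants_zero χ x) y (mem_mirabolicEquivariants_zero χ⁻¹ y)
  | m + 1, X, Y, hXY, B, hB, h => by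
    have htriv (x : X) (y : Y) : B (unipAverage X χ 0 x) y = 0 := by
      have h0 : ∀ y : Fin (m + 1) → F, (1 : R) = χ (0 ⬝ᵥ y) := by simp
      have h0' : ∀ y : Fin (m + 1) → F, (1 : R) = χ⁻¹ (0 ⬝ᵥ y) := by simp
      have hmem : descend hB χ 0 h0 h0' ∈ bilinearForms (psiMinus X).ρ (psiMinus Y).ρ := by
        intro g x y
        obtain ⟨x, rfl⟩ := Submodule.mkQ_surjective _ x
        obtain ⟨y, rfl⟩ := Submodule.mkQ_surjective _ y
        have h1 := apply_unipAverage_levi (χ := χ) hB 0 g x y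
        rw [Matrix.zero_vecMul] at h1
        exact h1
      have hbot : bilinearForms (psiMinus X).ρ (psiMinus Y).ρ = ⊥ :=
        hXY (m + 1) 0 rfl (Nat.le_add_left 1 m)
      have hzero := (Submodule.eq_bot_iff _).1 hbot _ hmem
      exact LinearMap.congr_fun₂ hzero ((unipRelations X fun _ => 1).mkQ x)
        ((unipRelations Y fun _ => 1).mkQ y)
    have heta (x : X) (y : Y) : B (unipAverage X χ (eta F (m + 1)) x) y = 0 := by
      have h1 : ∀ y : Fin (m + 1) → F, χ (y (Fin.last m)) = χ (eta F (m + 1) ⬝ᵥ y) := fun y => by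
        rw [eta_dotProduct]
      have h1' : ∀ y : Fin (m + 1) → F, χ⁻¹ (y (Fin.last m)) = χ⁻¹ (eta F (m + 1) ⬝ᵥ y) :=
        fun y => by rw [eta_dotProduct]
      have hmem : descend hB χ (eta F (m + 1)) h1 h1' ∈
          bilinearForms (phiMinus χ X).ρ (phiMinus χ⁻¹ Y).ρ := by
        intro g x y
        obtain ⟨x, rfl⟩ := phiMinusMk_surjective _ _ x
        obtain ⟨y, rfl⟩ := phiMinusMk_surjective _ _ y
        have h2 := apply_unipAverage_levi (χ := χ) hB (eta F (m + 1)) g.val x y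
        rw [mem_mirabolic_iff.1 g.2] at h2
        exact h2
      have hzero := eq_zero_of_forall_equivariants hq hχ m (phiMinus χ X) (phiMinus χ⁻¹ Y)
        (fun t k htk ht => by
          subst htk
          exact hXY t (k + 1) rfl ht) _ hmem fun x hx y hy => by
          obtain ⟨x, rfl⟩ := phiMinusMk_surjective _ _ x
          obtain ⟨y, rfl⟩ := phiMinusMk_surjective _ _ y
          have h3 := h _ (unipAverage_eta_mem_equivariants hx) _
            (unipAverage_eta_mem_equivariants hy)
          rw [apply_unipAverage_unipAverage hB] at h3
          exact (hq.pow _).mul_right_eq_zero.1 h3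
      exact LinearMap.congr_fun₂ hzero (phiMinusMk χ X x) (phiMinusMk χ⁻¹ Y y)
    have hall (a : Fin (m + 1) → F) (x : X) (y : Y) : B (unipAverage X χ a x) y = 0 := by
      rcases eq_or_ne a 0 with rfl | ha
      · exact htriv x y
      · obtain ⟨g, rfl⟩ := exists_eta_vecMul_eq ha
        rw [← apply_unipAverage_levi hB]
        exact heta _ _
    refine LinearMap.ext fun x => LinearMap.ext fun y => ?_
    refine (hq.pow (m + 1)).mul_right_eq_zero.1 ?_
    rw [← smul_eq_mul, ← LinearMap.smul_apply, ← map_smul, ← sum_unipAverage X hχ, map_sum,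
      LinearMap.sum_apply]
    exact Finset.sum_eq_zero fun a _ => hall a x y

end MirabolicForms

/-! ### Whittaker functions on the mirabolic group -/

section WhittakerFunctions

variable {F : Type*} [Field F] {R : Type*} [CommRing R]

/-- The functions on `GL_n(F)` with `W(gu) = χ(u) W(g)` for all `u` in `N_n`. -/
def rightEquivariants [Finite F] (χ : AddChar F R) (n : ℕ) : Submodule R (GL (Fin n) F → R) :=
  equivariants ((rightTranslation F R n).comp (unipotent F n).subtype) (whittakerChar χ n)

theorem mem_rightEquivariants [Finite F] {χ : AddChar F R} {n : ℕ} {W : GL (Fin n) F → R} :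
    W ∈ rightEquivariants χ n ↔
      ∀ u ∈ unipotent F n, ∀ g, W (g * u) = χ (superdiagonalSum u) * W g :=
  ⟨fun h u hu g => congrFun (h ⟨u, hu⟩) g, fun h u => funext fun g => h _ u.2 g⟩

/-- A function on `GL_{m+1}(F)` that transforms by `χ` under `N_{m+1}` on both sides vanishes on
the mirabolic subgroup outside `N_{m+1}`. -/
theorem eq_zero_of_mem_mirabolic_of_notMem_unipotent [Fintype F] (hq : IsUnit (Nat.card F : R))
    {χ : AddChar F R} (hχ : ∑ x, χ x = 0) : ∀ (m : ℕ) (f : GL (Fin (m + 1)) F → R)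
      (_ : f ∈ whittakerSpace χ (m + 1)) (_ : f ∈ rightEquivariants χ (m + 1))
      (g : GL (Fin (m + 1)) F) (_ : g ∈ mirabolic F m) (_ : g ∉ unipotent F (m + 1)), f g = 0
  | 0, f, _, _, g, hg, hg' => by
    refine (hg' ⟨fun i j hij => ?_, fun i => ?_⟩).elim
    · exact (hij.ne (Subsingleton.elim (α := Fin 1) j i)).elim
    · obtain rfl : i = Fin.last 0 := Subsingleton.elim (α := Fin 1) _ _
      have h : g.val (Fin.last 0) = Pi.single (Fin.last 0) 1 := hg
      rw [h, Pi.single_eq_same]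
  | m + 1, f, hl, hr, g, hg, hg' => by
    obtain ⟨h, y, rfl⟩ := exists_eq_blockGL_of_mem_mirabolic hg
    have hl' (z : Fin (m + 1) → F) (k : GL (Fin (m + 2)) F) :
        f ((unip z).val * k) = χ (z (Fin.last m)) * f k := by
      rw [hl _ (unip_mem_unipotent z), superdiagonalSum_unip]
    by_cases hh : h ∈ mirabolic F m
    · have key : f (blockGL h 0) = 0 := by
        refine eq_zero_of_mem_mirabolic_of_notMem_unipotent hq hχ m (fun k => f (blockGL k 0))
          (fun u hu k => ?_) (mem_rightEquivariants.2 fun u hu k => ?_) h hh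
          fun hu => hg' (blockGL_mem_unipotent hu y)
        · have h1 : blockGL (u * k) 0 = blockGL u 0 * blockGL k (0 : Fin (m + 1) → F) := by
            rw [blockGL_mul, Matrix.mulVec_zero, add_zero]
          show f (blockGL (u * k) 0) = _
          rw [h1, hl _ (blockGL_mem_unipotent hu 0), superdiagonalSum_blockGL, Pi.zero_apply,
            zero_add]
        · have h1 : blockGL (k * u) 0 = blockGL k 0 * blockGL u (0 : Fin (m + 1) → F) := by
            rw [blockGL_mul, Matrix.mulVec_zero, add_zero]
          show f (blockGL (k * u) 0) = _
          rw [h1, mem_rightEquivariants.1 hr _ (blockGL_mem_unipotent hu 0),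
            superdiagonalSum_blockGL, Pi.zero_apply, zero_add]
      rw [blockGL_eq_unip_mul_levi, Subgroup.coe_mul, hl']
      exact mul_eq_zero_of_right _ key
    · -- Moving `U_{m+2}` across `(h y; 0 1)` shows that a nontrivial character acts trivially
      -- on the value of `f`.
      set b : Fin (m + 1) → F := eta F (m + 1) - eta F (m + 1) ᵥ* h.val with hb
      have hb0 : b ≠ 0 := fun h0 => hh (mem_mirabolic_iff.2 (sub_eq_zero.1 h0).symm)
      have hz (z : Fin (m + 1) → F) : χ (b ⬝ᵥ z) * f (blockGL h y) = f (blockGL h y) := by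
        have h1 : blockGL h y * (unip z).val = (unip (h.val *ᵥ z)).val * blockGL h y := by
          show blockGL h y * blockGL 1 z = blockGL 1 (h.val *ᵥ z) * blockGL h y
          rw [blockGL_mul, blockGL_mul]
          simp [add_comm]
        have h2 := congrArg f h1
        rw [mem_rightEquivariants.1 hr _ (unip_mem_unipotent z), hl', superdiagonalSum_unip,
          ← eta_dotProduct z, ← eta_dotProduct (h.val *ᵥ z),
          Matrix.dotProduct_mulVec] at h2
        rw [hb, sub_dotProduct, sub_eq_add_neg, add_comm, AddChar.map_add_eq_mul, mul_assoc, h2,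
          ← mul_assoc, ← AddChar.map_add_eq_mul, neg_add_cancel, AddChar.map_zero_eq_one,
          one_mul]
      have hsum : (Nat.card F : R) ^ (m + 1) * f (blockGL h y) = 0 := by
        have h3 := sum_addChar_dotProduct hχ hb0
        have h4 : ∑ z : Fin (m + 1) → F, χ (b ⬝ᵥ z) * f (blockGL h y) =
            ∑ _z : Fin (m + 1) → F, f (blockGL h y) := Finset.sum_congr rfl fun z _ => hz z
        rw [← Finset.sum_mul, h3, zero_mul] at h4
        rw [h4]
        simp
      exact (hq.pow _).mul_right_eq_zero.1 hsum

/-- A right translation stable space of Whittaker functions that contains a function with value `1`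
at `1` contains one that transforms by `χ` under `N_n` on both sides. -/
theorem exists_rightEquivariant [Finite F] (hq : IsUnit (Nat.card F : R)) {χ : AddChar F R}
    {n : ℕ} {M : Submodule R (GL (Fin n) F → R)} (hM : M ≤ whittakerSpace χ n)
    (hM' : ∀ g, M ≤ M.comap (rightTranslation F R n g)) {W : GL (Fin n) F → R} (hW : W ∈ M)
    (hW1 : W 1 = 1) : ∃ W₀ ∈ M, W₀ ∈ rightEquivariants χ n ∧ W₀ 1 = 1 := by
  have := Fintype.ofFinite (unipotent F n)
  obtain ⟨c, hc⟩ := isUnit_card_unipotent hq n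
  set σ := (rightTranslation F R n).comp (unipotent F n).subtype with hσ
  have hstable (u : unipotent F n) (W : GL (Fin n) F → R) (hW : W ∈ M) : σ u W ∈ M :=
    hM' u.val hW
  have hmem : average σ (whittakerChar χ n) W ∈ M := by
    rw [average_apply]
    exact Submodule.sum_mem _ fun u _ => M.smul_mem _ (hstable u W hW)
  -- Evaluation at `1` does not distinguish left from right translation by `N_n`.
  have hval : (average σ (whittakerChar χ n) W) 1 = (Nat.card (unipotent F n) : R) := by
    have h : ∀ (u : unipotent F n), (σ u W) 1 = whittakerChar χ n u * W 1 := fun u => by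
      have h1 := hM hW u.val u.2 1
      rw [mul_one] at h1
      show W (1 * u.val) = _
      rw [one_mul]
      exact h1
    rw [average_apply, Finset.sum_apply, Finset.sum_congr rfl fun u _ => by
      rw [Pi.smul_apply, h, smul_eq_mul, ← mul_assoc, char_inv_mul_self, one_mul, hW1]]
    rw [Finset.sum_const, Finset.card_univ, Nat.card_eq_fintype_card, nsmul_eq_mul, mul_one]
  refine ⟨(↑c⁻¹ : R) • average σ (whittakerChar χ n) W, M.smul_mem _ hmem,
    Submodule.smul_mem _ _ (average_mem_equivariants _ _ W), ?_⟩
  rw [Pi.smul_apply, hval, ← hc, smul_eq_mul, Units.inv_mul]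

end WhittakerFunctions

/-! ### Whittaker vectors in Whittaker models -/

section Model

variable {F : Type*} [Field F] {R : Type*} [CommRing R]

theorem span_coord_eq_top {M : Type*} [AddCommGroup M] [Module R M] (b : Module.Basis Unit R M) :
    Submodule.span R {b.coord ()} = ⊤ := by
  refine eq_top_iff.2 fun l _ => Submodule.mem_span_singleton.2 ⟨l (b ()), b.ext fun i => ?_⟩
  simp

theorem whittakerMap_rep (χ : AddChar F R) {n : ℕ} (V : Rep R (GL (Fin n) F))
    (l : topDerivative χ V →ₗ[R] R) (g : GL (Fin n) F) (v : V) :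
    whittakerMap χ V l (V.ρ g v) = rightTranslation F R n g (whittakerMap χ V l v) := by
  funext x
  simp [whittakerMap, rightTranslation, LinearMap.funLeft]

theorem whittakerMap_one (χ : AddChar F R) {n : ℕ} (V : Rep R (GL (Fin n) F))
    (l : topDerivative χ V →ₗ[R] R) (v : V) :
    whittakerMap χ V l v 1 = l (derivativeProj χ 0 n (zero_add n) V v) := by
  simp [whittakerMap]

theorem exists_mem_whittakerModel_one {χ : AddChar F R} {n : ℕ} {V : Rep R (GL (Fin n) F)}
    (hV : IsWhittakerType χ V) : ∃ W ∈ whittakerModel χ V, W 1 = 1 := by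
  obtain ⟨b⟩ := hV
  obtain ⟨v, hv⟩ := derivativeProj_surjective χ 0 n (zero_add n) V (b ())
  refine ⟨whittakerMap χ V (b.coord ()) v, ?_, ?_⟩
  · rw [whittakerModel_eq_range χ V _ (span_coord_eq_top b)]
    exact ⟨v, rfl⟩
  · rw [whittakerMap_one, hv]
    simp

/-- The Whittaker vectors of the Whittaker model are determined by their value at `1`. -/
theorem eq_zero_of_mem_whittakerModel [Fintype F] (hq : IsUnit (Nat.card F : R))
    {χ : AddChar F R} {n : ℕ} {V : Rep R (GL (Fin n) F)} (hV : IsWhittakerType χ V)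
    {W : GL (Fin n) F → R} (hW : W ∈ whittakerModel χ V) (hW' : W ∈ rightEquivariants χ n)
    (h1 : W 1 = 0) : W = 0 := by
  obtain ⟨b⟩ := hV
  rw [whittakerModel_eq_range χ V _ (span_coord_eq_top b)] at hW
  obtain ⟨v, rfl⟩ := hW
  set σ := V.ρ.comp (unipotent F n).subtype with hσ
  have hav : whittakerMap χ V (b.coord ()) (average σ (whittakerChar χ n) v) =
      (Nat.card (unipotent F n) : R) • whittakerMap χ V (b.coord ()) v := by
    refine Eq.trans ?_ (average_of_mem_equivariants hW')
    have := Fintype.ofFinite (unipotent F n)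
    rw [average_apply, average_apply, map_sum]
    refine Finset.sum_congr rfl fun u _ => ?_
    rw [map_smul]
    exact congrArg _ (whittakerMap_rep χ V _ u.val v)
  have hproj : derivativeProj χ 0 n (zero_add n) V (average σ (whittakerChar χ n) v) = 0 := by
    rw [← b.forall_coord_eq_zero_iff]
    intro i
    rw [← whittakerMap_one, hav, Pi.smul_apply, h1, smul_zero]
  have hzero : average σ (whittakerChar χ n) v = 0 :=
    derivativeProj_injOn hq χ 0 n rfl _ V _ (average_mem_equivariants _ _ v) hproj
  rw [hzero, map_zero] at hav
  exact (isUnit_card_unipotent hq n).smul_eq_zero.1 hav.symm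

end Model

/-! ### The sums `I(W, W', Φ)` -/

section ZetaSum

variable {F : Type*} [Field F] {R : Type*} [CommRing R]

theorem bijective_unipotent_mul_out [Finite F] (n : ℕ) : Function.Bijective
    fun x : Quotient (QuotientGroup.rightRel (unipotent F n)) × unipotent F n =>
      x.2.val * x.1.out := by
  have hmk (x : Quotient (QuotientGroup.rightRel (unipotent F n))) (u : unipotent F n) :
      Quotient.mk (QuotientGroup.rightRel (unipotent F n)) (u.val * x.out) = x := by
    refine Eq.trans (Quotient.sound ?_) x.out_eq
    rw [← Quotient.eq_iff_equiv, Quotient.eq, QuotientGroup.rightRel_apply, _root_.mul_inv_rev,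
      mul_inv_cancel_left]
    exact inv_mem u.2
  constructor
  · rintro ⟨x, u⟩ ⟨y, v⟩ h
    have hxy : x = y := by
      rw [← hmk x u, ← hmk y v]
      exact congrArg _ h
    subst hxy
    exact Prod.ext rfl (Subtype.ext (mul_right_cancel h))
  · intro g
    have h := Quotient.exact (Quotient.out_eq (Quotient.mk (QuotientGroup.rightRel
      (unipotent F n)) g))
    rw [← Quotient.eq_iff_equiv, Quotient.eq, QuotientGroup.rightRel_apply] at h
    exact ⟨(_, ⟨_, h⟩), inv_mul_cancel_right _ _⟩

theorem eta_vecMul_unipotent_mul [Finite F] {n : ℕ} {u : GL (Fin (n + 1)) F}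
    (hu : u ∈ unipotent F (n + 1)) (g : GL (Fin (n + 1)) F) :
    eta F (n + 1) ᵥ* (u * g).val = eta F (n + 1) ᵥ* g.val := by
  rw [Units.val_mul, ← Matrix.vecMul_vecMul, mem_mirabolic_iff.1 (unipotent_le_mirabolic n hu)]

theorem char_mul_inv (χ : AddChar F R) (x : F) : χ x * χ⁻¹ x = 1 := by
  rw [AddChar.inv_apply, ← AddChar.map_add_eq_mul, add_neg_cancel, AddChar.map_zero_eq_one]

/-- The sum over `N_n \ GL_n(F)` is the sum over `GL_n(F)` divided by `|N_n|`. -/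
theorem card_mul_zetaSum [Finite F] [Fintype (GL (Fin (n + 1)) F)] {χ : AddChar F R}
    {W W' : GL (Fin (n + 1)) F → R} (hW : W ∈ whittakerSpace χ (n + 1))
    (hW' : W' ∈ whittakerSpace χ⁻¹ (n + 1)) (Φ : (Fin (n + 1) → F) → R) :
    (Nat.card (unipotent F (n + 1)) : R) * zetaSum W W' Φ =
      ∑ g, W g * W' g * Φ (eta F (n + 1) ᵥ* g.val) := by
  have := Fintype.ofFinite (unipotent F (n + 1))
  have := Fintype.ofFinite (Quotient (QuotientGroup.rightRel (unipotent F (n + 1))))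
  rw [← (bijective_unipotent_mul_out (n + 1)).sum_comp, Fintype.sum_prod_type, zetaSum,
    finsum_eq_sum_of_fintype, Finset.mul_sum]
  refine Finset.sum_congr rfl fun x _ => ?_
  rw [Finset.sum_congr rfl fun u _ => by
    rw [hW _ u.2, hW' _ u.2, eta_vecMul_unipotent_mul u.2, mul_mul_mul_comm, char_mul_inv,
      one_mul]]
  dsimp only
  rw [Finset.sum_const, Finset.card_univ, Nat.card_eq_fintype_card, nsmul_eq_mul]

theorem zetaSum_single_eta [Fintype F] [DecidableEq F] (hq : IsUnit (Nat.card F : R))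
    {χ : AddChar F R} (hχ : ∑ x, χ x = 0) {n : ℕ} {W W' : GL (Fin (n + 1)) F → R}
    (hW : W ∈ whittakerSpace χ (n + 1)) (hWr : W ∈ rightEquivariants χ (n + 1)) (hW1 : W 1 = 1)
    (hW' : W' ∈ whittakerSpace χ⁻¹ (n + 1)) (hW'1 : W' 1 = 1) :
    zetaSum W W' (Pi.single (eta F (n + 1)) 1) = 1 := by
  classical
  refine (isUnit_card_unipotent hq (n + 1)).mul_left_cancel ?_
  rw [card_mul_zetaSum hW hW', mul_one]
  have h (g : GL (Fin (n + 1)) F) : W g * W' g *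
      (Pi.single (eta F (n + 1)) 1 : (Fin (n + 1) → F) → R) (eta F (n + 1) ᵥ* g.val) =
        if g ∈ unipotent F (n + 1) then 1 else 0 := by
    split_ifs with hg
    · have h1 := hW g hg 1
      have h2 := hW' g hg 1
      rw [mul_one, hW1, mul_one] at h1
      rw [mul_one, hW'1, mul_one] at h2
      rw [h1, h2, mem_mirabolic_iff.1 (unipotent_le_mirabolic n hg), Pi.single_eq_same, mul_one,
        char_mul_inv]
    · by_cases hgm : g ∈ mirabolic F n
      · rw [eq_zero_of_mem_mirabolic_of_notMem_unipotent hq hχ n W hW hWr g hgm hg, zero_mul,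
          zero_mul]
      · rw [Pi.single_eq_of_ne fun h0 => hgm (mem_mirabolic_iff.2 h0), mul_zero]
  rw [Finset.sum_congr rfl fun g _ => h g, Finset.sum_boole, Nat.card_eq_fintype_card,
    Fintype.card_subtype]

/-- The trilinear form `(m, m', m'') ↦ I(A m, A' m', A'' m'')`. -/
noncomputable def zetaTrilinear [Finite F] {n : ℕ} {M M' M'' : Type*} [AddCommGroup M]
    [Module R M] [AddCommGroup M'] [Module R M'] [AddCommGroup M''] [Module R M'']
    (A : M →ₗ[R] GL (Fin n) F → R) (A' : M' →ₗ[R] GL (Fin n) F → R)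
    (A'' : M'' →ₗ[R] (Fin n → F) → R) : M →ₗ[R] M' →ₗ[R] M'' →ₗ[R] R :=
  letI := Fintype.ofFinite (Quotient (QuotientGroup.rightRel (unipotent F n)))
  ∑ x : Quotient (QuotientGroup.rightRel (unipotent F n)),
    ((LinearMap.proj x.out).comp A).smulRight (((LinearMap.proj x.out).comp A').smulRight
      ((LinearMap.proj (eta F n ᵥ* x.out.val)).comp A''))

theorem zetaTrilinear_apply [Finite F] {n : ℕ} {M M' M'' : Type*} [AddCommGroup M]
    [Module R M] [AddCommGroup M'] [Module R M'] [AddCommGroup M''] [Module R M'']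
    (A : M →ₗ[R] GL (Fin n) F → R) (A' : M' →ₗ[R] GL (Fin n) F → R)
    (A'' : M'' →ₗ[R] (Fin n → F) → R) (m : M) (m' : M') (m'' : M'') :
    zetaTrilinear A A' A'' m m' m'' = zetaSum (A m) (A' m') (A'' m'') := by
  let := Fintype.ofFinite (Quotient (QuotientGroup.rightRel (unipotent F n)))
  rw [zetaSum, finsum_eq_sum_of_fintype]
  simp [zetaTrilinear, LinearMap.sum_apply, mul_assoc]

theorem zetaSum_translate [Finite F] (hq : IsUnit (Nat.card F : R)) {χ : AddChar F R} {n : ℕ}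
    {W W' : GL (Fin (n + 1)) F → R} (hW : W ∈ whittakerSpace χ (n + 1))
    (hW' : W' ∈ whittakerSpace χ⁻¹ (n + 1)) (Φ : (Fin (n + 1) → F) → R)
    (g : GL (Fin (n + 1)) F) :
    zetaSum (rightTranslation F R (n + 1) g W) (rightTranslation F R (n + 1) g W')
      (functionRep F R (n + 1) g Φ) = zetaSum W W' Φ := by
  have := Fintype.ofFinite (GL (Fin (n + 1)) F)
  have hstable (χ : AddChar F R) {W : GL (Fin (n + 1)) F → R}
      (hW : W ∈ whittakerSpace χ (n + 1)) :
      rightTranslation F R (n + 1) g W ∈ whittakerSpace χ (n + 1) := fun u hu k => by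
    show W (u * k * g) = _ * W (k * g)
    rw [mul_assoc, hW u hu]
  refine (isUnit_card_unipotent hq (n + 1)).mul_left_cancel ?_
  rw [card_mul_zetaSum (hstable χ hW) (hstable χ⁻¹ hW'), card_mul_zetaSum hW hW']
  refine Fintype.sum_equiv (Equiv.mulRight g) _ _ fun k => ?_
  show W (k * g) * W' (k * g) * Φ ((eta F (n + 1) ᵥ* k.val) ᵥ* g.val) =
    W (k * g) * W' (k * g) * Φ (eta F (n + 1) ᵥ* (k * g).val)
  rw [Matrix.vecMul_vecMul, Units.val_mul]

end ZetaSum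

/-! ### The involution `W ↦ W̃` and the Fourier transform -/

section Duality

variable {F : Type*} [Field F] {R : Type*} [CommRing R]

variable (F R) in
/-- The map `W ↦ W̃` as a linear map. -/
def tildeLinear (n : ℕ) : (GL (Fin n) F → R) →ₗ[R] (GL (Fin n) F → R) :=
  LinearMap.funLeft R R fun g => longWeyl F n * transposeInv g

theorem tildeLinear_apply {n : ℕ} (W : GL (Fin n) F → R) : tildeLinear F R n W = tilde W :=
  rfl

theorem tilde_mem_whittakerSpace [Finite F] {χ : AddChar F R} {n : ℕ} {W : GL (Fin n) F → R}
    (hW : W ∈ whittakerSpace χ n) : tilde W ∈ whittakerSpace χ⁻¹ n := by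
  intro u hu g
  have h : longWeyl F n * transposeInv (u * g) =
      (longWeyl F n * transposeInv u * longWeyl F n) * (longWeyl F n * transposeInv g) := by
    rw [transposeInv_mul, mul_assoc _ (longWeyl F n), ← mul_assoc (longWeyl F n) (longWeyl F n),
      longWeyl_mul_self, one_mul, mul_assoc]
  show W (longWeyl F n * transposeInv (u * g)) = _ * W (longWeyl F n * transposeInv g)
  rw [h, hW _ (longWeyl_conj_transposeInv_mem_unipotent hu),
    superdiagonalSum_longWeyl_conj_transposeInv hu, AddChar.inv_apply]

theorem tilde_rightTranslation {n : ℕ} (W : GL (Fin n) F → R) (g : GL (Fin n) F) :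
    tilde (rightTranslation F R n g W) = rightTranslation F R n (transposeInv g) (tilde W) := by
  funext k
  show W (longWeyl F n * transposeInv k * g) =
    W (longWeyl F n * transposeInv (k * transposeInv g))
  rw [transposeInv_mul, transposeInv_transposeInv, mul_assoc]

variable [Fintype F]

/-- The Fourier transform as a linear map. -/
noncomputable def fourierLinear (χ : AddChar F R) (n : ℕ) :
    ((Fin n → F) → R) →ₗ[R] ((Fin n → F) → R) where
  toFun := finiteFourier χ
  map_add' Φ Φ' := by
    funext a
    simp [finiteFourier, add_mul, Finset.sum_add_distrib]
  map_smul' c Φ := by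
    funext a
    simp [finiteFourier, Finset.mul_sum, mul_assoc]

theorem finiteFourier_functionRep (χ : AddChar F R) {n : ℕ} (Φ : (Fin n → F) → R)
    (g : GL (Fin n) F) : finiteFourier χ (functionRep F R n g Φ) =
      functionRep F R n (transposeInv g) (finiteFourier χ Φ) := by
  have hinv : g.val * g⁻¹.val = 1 := by rw [← Units.val_mul, mul_inv_cancel]; rfl
  have hinv' : g⁻¹.val * g.val = 1 := by rw [← Units.val_mul, inv_mul_cancel]; rfl
  funext a
  show ∑ x : Fin n → F, Φ (x ᵥ* g.val) * χ (a ⬝ᵥ x) =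
    ∑ x : Fin n → F, Φ x * χ ((a ᵥ* (g⁻¹.val)ᵀ) ⬝ᵥ x)
  refine Fintype.sum_equiv ⟨fun x => x ᵥ* g.val, fun x => x ᵥ* g⁻¹.val, fun x => ?_, fun x => ?_⟩
    _ _ fun x => ?_
  · show (x ᵥ* g.val) ᵥ* g⁻¹.val = x
    rw [Matrix.vecMul_vecMul, hinv, Matrix.vecMul_one]
  · show (x ᵥ* g⁻¹.val) ᵥ* g.val = x
    rw [Matrix.vecMul_vecMul, hinv', Matrix.vecMul_one]
  · rw [Equiv.coe_fn_mk, ← Matrix.dotProduct_mulVec, Matrix.mulVec_transpose,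
      Matrix.vecMul_vecMul, hinv, Matrix.vecMul_one]

theorem exists_finiteFourier_eq_single [DecidableEq F] (hq : IsUnit (Nat.card F : R))
    {χ : AddChar F R} (hχ : ∑ x, χ x = 0) {n : ℕ} (b : Fin n → F) :
    ∃ Φ, finiteFourier χ Φ = Pi.single b (1 : R) := by
  obtain ⟨c, hc⟩ := hq.pow n
  refine ⟨fun x => ↑c⁻¹ * χ (-b ⬝ᵥ x), funext fun a => ?_⟩
  have h (x : Fin n → F) : (↑c⁻¹ : R) * χ (-b ⬝ᵥ x) * χ (a ⬝ᵥ x) =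
      ↑c⁻¹ * χ ((a - b) ⬝ᵥ x) := by
    rw [mul_assoc, ← AddChar.map_add_eq_mul, ← add_dotProduct, neg_add_eq_sub]
  rw [finiteFourier, Finset.sum_congr rfl fun x _ => h x, ← Finset.mul_sum,
    sum_addChar_dotProduct_eq_ite hχ, Pi.single_apply]
  simp only [sub_eq_zero]
  split_ifs
  · rw [← hc, Units.inv_mul]
  · rw [mul_zero]

end Duality

/-! ### Invariant trilinear forms -/

section Trilinear

variable {F : Type*} [Field F] {R : Type*} [CommRing R]

theorem functionRep_single [DecidableEq F] {n : ℕ} (x : Fin n → F) (g : GL (Fin n) F) :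
    functionRep F R n g (Pi.single (x ᵥ* g.val) 1) = Pi.single x 1 := by
  funext k
  show (Pi.single (x ᵥ* g.val) 1 : (Fin n → F) → R) (k ᵥ* g.val) = _
  have hinj : Function.Injective fun k : Fin n → F => k ᵥ* g.val :=
    Matrix.vecMul_injective_of_isUnit g.isUnit
  rw [Pi.single_apply, Pi.single_apply]
  exact if_congr hinj.eq_iff rfl rfl

/-- The hypothesis of `eq_zero_of_forall_equivariants` on derivatives of positive rank, for the
restrictions of two Whittaker models to the mirabolic subgroup. -/
theorem bilinearForms_mirabolicDerivative_eq_bot {χ : AddChar F R} {m : ℕ}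
    {V V' : Rep R (GL (Fin (m + 1)) F)} (h : ¬ IsExceptionalPair χ V V') (t k : ℕ)
    (hm : m = t + k) (ht : 1 ≤ t) :
    bilinearForms
      (mirabolicDerivative χ t k (hm ▸ restrictMirabolic (whittakerRep χ V))).ρ
      (mirabolicDerivative χ⁻¹ t k (hm ▸ restrictMirabolic (whittakerRep χ⁻¹ V'))).ρ = ⊥ := by
  subst hm
  by_contra hne
  exact h ⟨t, k + 1, k + 1, rfl, rfl, ht, hne⟩

theorem bilinearForms_whittakerRep_eq_bot {χ : AddChar F R} {m : ℕ}
    {V V' : Rep R (GL (Fin (m + 1)) F)} (h : ¬ IsExceptionalPair χ V V') :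
    bilinearForms (whittakerRep χ V).ρ (whittakerRep χ⁻¹ V').ρ = ⊥ := by
  by_contra hne
  exact h ⟨m + 1, 0, 0, rfl, rfl, Nat.le_add_left 1 m, hne⟩

variable [Fintype F]

/-- A Whittaker vector in a Whittaker model is its value at `1` times the normalized one. -/
theorem eq_smul_of_mem_rightEquivariants (hq : IsUnit (Nat.card F : R)) {χ : AddChar F R} {n : ℕ}
    {V : Rep R (GL (Fin n) F)} (hV : IsWhittakerType χ V) {W₀ W : whittakerModel χ V}
    (hW₀ : W₀.val ∈ rightEquivariants χ n) (hW₀1 : W₀.val 1 = 1)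
    (hW : W.val ∈ rightEquivariants χ n) : W = W.val 1 • W₀ := by
  refine Subtype.ext (sub_eq_zero.1 (eq_zero_of_mem_whittakerModel hq hV
    (Submodule.sub_mem _ W.2 (W.val 1 • W₀).2)
    (Submodule.sub_mem _ hW (Submodule.smul_mem _ _ hW₀)) ?_))
  simp [hW₀1]

theorem mem_rightEquivariants_of_mem_mirabolicEquivariants {χ χ' : AddChar F R} {n : ℕ}
    {V : Rep R (GL (Fin (n + 1)) F)} {W : whittakerModel χ V}
    (hW : W ∈ mirabolicEquivariants χ' (restrictMirabolic (whittakerRep χ V))) :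
    W.val ∈ rightEquivariants χ' (n + 1) :=
  fun u => congrArg Subtype.val (hW u)

/-- For a pair that is not exceptional, an invariant trilinear form is determined by one value.
Its value on the delta function at `η` is a form invariant under the mirabolic subgroup, hence
determined by Whittaker vectors. This determines its values on the delta functions at all nonzero
vectors by translation, and its value on the delta function at `0` is a `GL_n(F)`-invariant bilinear
form, which vanishes. -/
theorem trilinearForm_eq_zero [DecidableEq F] (hq : IsUnit (Nat.card F : R)) {χ : AddChar F R}
    (hχ : ∑ x, χ x = 0) {m : ℕ} {V V' : Rep R (GL (Fin (m + 1)) F)} (hV : IsWhittakerType χ V)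
    (hV' : IsWhittakerType χ⁻¹ V') (hVV' : ¬ IsExceptionalPair χ V V')
    {W₀ : whittakerModel χ V} (hW₀ : W₀.val ∈ rightEquivariants χ (m + 1))
    (hW₀1 : W₀.val 1 = 1) {W₀' : whittakerModel χ⁻¹ V'}
    (hW₀' : W₀'.val ∈ rightEquivariants χ⁻¹ (m + 1)) (hW₀'1 : W₀'.val 1 = 1)
    {T : whittakerRep χ V →ₗ[R] whittakerRep χ⁻¹ V' →ₗ[R] ((Fin (m + 1) → F) → R) →ₗ[R] R}
    (hT : T ∈ trilinearForms (whittakerRep χ V).ρ (whittakerRep χ⁻¹ V').ρ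
      (functionRep F R (m + 1)))
    (h : T W₀ W₀' (Pi.single (eta F (m + 1)) 1) = 0) : T = 0 := by
  let B (x : Fin (m + 1) → F) : whittakerRep χ V →ₗ[R] whittakerRep χ⁻¹ V' →ₗ[R] R :=
    T.compr₂ (LinearMap.applyₗ (Pi.single x 1))
  have hBapply (x : Fin (m + 1) → F) (W : whittakerRep χ V) (W' : whittakerRep χ⁻¹ V') :
      B x W W' = T W W' (Pi.single x 1) := rfl
  have hBrep (x : Fin (m + 1) → F) (g : GL (Fin (m + 1)) F) (W : whittakerRep χ V)
      (W' : whittakerRep χ⁻¹ V') :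
      B x ((whittakerRep χ V).ρ g W) ((whittakerRep χ⁻¹ V').ρ g W') = B (x ᵥ* g.val) W W' := by
    rw [hBapply, ← functionRep_single x g, hT, hBapply]
  have hBsmul (W : whittakerRep χ V) (W' : whittakerRep χ⁻¹ V')
      (hWW' : B (eta F (m + 1)) W W' = 0) (c c' : R) :
      B (eta F (m + 1)) (c • W) (c' • W') = 0 := by
    rw [LinearMap.map_smul₂, map_smul, hWW', smul_zero, smul_zero]
  have hBeta : B (eta F (m + 1)) = 0 := by
    refine eq_zero_of_forall_equivariants hq hχ m (restrictMirabolic (whittakerRep χ V))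
      (restrictMirabolic (whittakerRep χ⁻¹ V'))
      (bilinearForms_mirabolicDerivative_eq_bot hVV') (B (eta F (m + 1))) (fun g W W' => ?_)
      fun W hW W' hW' => ?_
    · refine (hBrep _ g.val W W').trans ?_
      rw [mem_mirabolic_iff.1 g.2]
      rfl
    · have h1 := eq_smul_of_mem_rightEquivariants hq hV hW₀ hW₀1
        (mem_rightEquivariants_of_mem_mirabolicEquivariants hW)
      have h2 := eq_smul_of_mem_rightEquivariants hq hV' hW₀' hW₀'1
        (mem_rightEquivariants_of_mem_mirabolicEquivariants hW')
      exact (congrArg₂ (fun W W' => B (eta F (m + 1)) W W') h1 h2).trans (hBsmul W₀ W₀' h _ _)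
  have hBall (x : Fin (m + 1) → F) : B x = 0 := by
    rcases eq_or_ne x 0 with rfl | hx
    · refine (Submodule.eq_bot_iff _).1 (bilinearForms_whittakerRep_eq_bot hVV') _
        fun g W W' => ?_
      rw [hBrep, Matrix.zero_vecMul]
    · obtain ⟨g, rfl⟩ := exists_eta_vecMul_eq hx
      ext W W'
      rw [← hBrep, hBeta]
      rfl
  refine LinearMap.ext fun W => LinearMap.ext fun W' =>
    (Pi.basisFun R (Fin (m + 1) → F)).ext fun x => ?_
  rw [Pi.basisFun_apply, ← hBapply, hBall]
  rfl

end Trilinear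

/-! ### The coefficient ring -/

section Coefficients

theorem isDomain_baseRing (p : ℕ) [Fact p.Prime] : IsDomain (BaseRing p) := by
  have h : Submonoid.powers (p : CyclotomicRing p ℤ ℚ) ≤
      nonZeroDivisors (CyclotomicRing p ℤ ℚ) := by
    refine powers_le_nonZeroDivisors_of_noZeroDivisors ?_
    have hinj : Function.Injective (algebraMap ℤ (CyclotomicRing p ℤ ℚ)) :=
      FaithfulSMul.algebraMap_injective ℤ (CyclotomicRing p ℤ ℚ)
    have h0 : ((p : ℤ) : CyclotomicRing p ℤ ℚ) ≠ 0 := fun h0 =>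
      (Nat.cast_ne_zero.2 (Fact.out : p.Prime).ne_zero : (p : ℤ) ≠ 0)
        (hinj (by rw [map_zero, ← h0]; simp))
    simpa using h0
  exact IsLocalization.isDomain_localization h

theorem isUnit_card (p : ℕ) (F : Type*) [Field F] [Fintype F] [CharP F p] (R : Type*) [CommRing R]
    [Algebra (BaseRing p) R] : IsUnit (Nat.card F : R) := by
  obtain ⟨k, _, hk⟩ := FiniteField.card F p
  have hp : IsUnit (p : R) := by
    have h := (IsLocalization.Away.algebraMap_isUnit (S := BaseRing p)
      (p : CyclotomicRing p ℤ ℚ)).map (algebraMap (BaseRing p) R)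
    simpa using h
  rw [Nat.card_eq_fintype_card, hk, Nat.cast_pow]
  exact hp.pow _

theorem sum_extendChar {p : ℕ} [Fact p.Prime] {F : Type*} [Field F] [Fintype F]
    {ψ : AddChar F (BaseRing p)} (hψ : ψ ≠ 1) (R : Type*) [CommRing R] [Algebra (BaseRing p) R] :
    ∑ x, extendChar R ψ x = 0 := by
  have := isDomain_baseRing p
  have h : ∑ x, ψ x = 0 := AddChar.sum_eq_zero_of_ne_one hψ
  have h' := congrArg (algebraMap (BaseRing p) R) h
  rw [map_sum, map_zero] at h'
  exact h'

end Coefficients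

/-! ### The functional equation -/

section FunctionalEquation

variable {F : Type*} [Field F] [Fintype F] {R : Type*} [CommRing R]

theorem exists_rightEquivariant_whittakerModel (hq : IsUnit (Nat.card F : R)) {χ : AddChar F R}
    {n : ℕ} {V : Rep R (GL (Fin n) F)} (hV : IsWhittakerType χ V) :
    ∃ W : whittakerModel χ V, W.val ∈ rightEquivariants χ n ∧ W.val 1 = 1 := by
  obtain ⟨W, hW, hW1⟩ := exists_mem_whittakerModel_one hV
  obtain ⟨W₀, h, h', h''⟩ := exists_rightEquivariant hq (whittakerModel_le_whittakerSpace χ V)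
    (whittakerModel_le_comap χ V) hW hW1
  exact ⟨⟨W₀, h⟩, h', h''⟩

/-- The functions `W̃` form a right translation stable space of Whittaker functions for `χ⁻¹`, with
value `1` at `1` attained by the translate by `w_n` of a function with value `1` at `1`. -/
theorem exists_tilde_rightEquivariant (hq : IsUnit (Nat.card F : R)) {χ : AddChar F R}
    {n : ℕ} {V : Rep R (GL (Fin n) F)} (hV : IsWhittakerType χ V) :
    ∃ W : whittakerModel χ V, tilde W.val ∈ rightEquivariants χ⁻¹ n ∧ tilde W.val 1 = 1 := by
  obtain ⟨W, hW, hW1⟩ := exists_mem_whittakerModel_one hV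
  have htilde : tilde (rightTranslation F R n (longWeyl F n) W) 1 = 1 := by
    have h1 : transposeInv (1 : GL (Fin n) F) = 1 := Units.ext (by simp [transposeInv])
    show W (longWeyl F n * transposeInv 1 * longWeyl F n) = 1
    rw [h1, mul_one, longWeyl_mul_self, hW1]
  obtain ⟨_, ⟨W₀, h, rfl⟩, h', h''⟩ := exists_rightEquivariant (χ := χ⁻¹)
    (M := (whittakerModel χ V).map (tildeLinear F R n)) hq
    (Submodule.map_le_iff_le_comap.2 fun W hW =>
      tilde_mem_whittakerSpace (whittakerModel_le_whittakerSpace χ V hW))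
    (fun g => Submodule.map_le_iff_le_comap.2 fun W hW =>
      ⟨_, whittakerModel_le_comap χ V (transposeInv g) hW, by
        rw [tildeLinear_apply, tilde_rightTranslation, transposeInv_transposeInv]
        rfl⟩)
    (Submodule.mem_map_of_mem (whittakerModel_le_comap χ V (longWeyl F n) hW)) htilde
  exact ⟨⟨W₀, h⟩, h', h''⟩

/-- The generator and the gamma factor over any ring `R` in which `|F|` is invertible, for any
character `χ` of `F` whose values sum to zero. -/
theorem functionalEquation (hq : IsUnit (Nat.card F : R)) {χ : AddChar F R}
    (hχ : ∑ x, χ x = 0) {m : ℕ} {V V' : Rep R (GL (Fin (m + 1)) F)}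
    (hV : IsWhittakerType χ V) (hV' : IsWhittakerType χ V')
    (hVV' : ¬ IsExceptionalPair χ V V') :
    (∃ b : Module.Basis Unit R (trilinearForms (whittakerRep χ V).ρ
          (whittakerRep χ⁻¹ V').ρ (functionRep F R (m + 1))),
        ∀ (W : whittakerModel χ V) (W' : whittakerModel χ⁻¹ V') (Φ : (Fin (m + 1) → F) → R),
          (b ()).val W W' Φ = zetaSum W.val W'.val Φ) ∧
      ∃! γ : Rˣ, ∀ W ∈ whittakerModel χ V, ∀ W' ∈ whittakerModel χ⁻¹ V',
        ∀ Φ : (Fin (m + 1) → F) → R,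
          zetaSum W W' Φ * (γ : R) = zetaSum (tilde W) (tilde W') (finiteFourier χ Φ) := by
  classical
  replace hV' := hV'.inv hq
  obtain ⟨W₀, hW₀, hW₀1⟩ := exists_rightEquivariant_whittakerModel hq hV
  obtain ⟨W₀', hW₀', hW₀'1⟩ := exists_rightEquivariant_whittakerModel hq hV'
  have hle {W : GL (Fin (m + 1)) F → R} (hW : W ∈ whittakerModel χ V) :=
    whittakerModel_le_whittakerSpace χ V hW
  have hle' {W : GL (Fin (m + 1)) F → R} (hW : W ∈ whittakerModel χ⁻¹ V') :=
    whittakerModel_le_whittakerSpace χ⁻¹ V' hW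
  let I : trilinearForms (whittakerRep χ V).ρ (whittakerRep χ⁻¹ V').ρ
      (functionRep F R (m + 1)) :=
    ⟨zetaTrilinear (whittakerModel χ V).subtype (whittakerModel χ⁻¹ V').subtype LinearMap.id,
      fun g W W' Φ => by
        erw [zetaTrilinear_apply, zetaTrilinear_apply]
        exact zetaSum_translate hq (hle W.2) (hle' W'.2) Φ g⟩
  have hI (W : whittakerModel χ V) (W' : whittakerModel χ⁻¹ V') (Φ : (Fin (m + 1) → F) → R) :
      I.val W W' Φ = zetaSum W.val W'.val Φ := zetaTrilinear_apply _ _ _ W W' Φ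
  have hI1 : zetaSum W₀.val W₀'.val (Pi.single (eta F (m + 1)) 1) = 1 :=
    zetaSum_single_eta hq hχ (hle W₀.2) hW₀ hW₀1 (hle' W₀'.2) hW₀'1
  have hgen (T : trilinearForms (whittakerRep χ V).ρ (whittakerRep χ⁻¹ V').ρ
      (functionRep F R (m + 1))) :
      T = T.val W₀ W₀' (Pi.single (eta F (m + 1)) 1) • I := by
    set c := T.val W₀ W₀' (Pi.single (eta F (m + 1)) 1) with hc
    have hzero := trilinearForm_eq_zero hq hχ hV hV' hVV' hW₀ hW₀1 hW₀' hW₀'1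
      (Submodule.add_mem _ T.2 (Submodule.smul_mem _ (-c) I.2)) (by
        show T.val W₀ W₀' _ + -c * I.val W₀ W₀' _ = 0
        rw [hI, hI1, mul_one, ← hc, add_neg_cancel])
    refine Subtype.ext (LinearMap.ext fun W => LinearMap.ext fun W' => LinearMap.ext fun Φ => ?_)
    have h1 : T.val W W' Φ + -c * I.val W W' Φ = 0 :=
      LinearMap.congr_fun (LinearMap.congr_fun₂ hzero W W') Φ
    show T.val W W' Φ = c * I.val W W' Φ
    rwa [neg_mul, add_neg_eq_zero] at h1
  let e : R ≃ₗ[R] trilinearForms (whittakerRep χ V).ρ (whittakerRep χ⁻¹ V').ρ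
      (functionRep F R (m + 1)) :=
    { LinearMap.toSpanSingleton R _ I with
      invFun := fun T => T.val W₀ W₀' (Pi.single (eta F (m + 1)) 1)
      left_inv := fun c => by
        show c * I.val W₀ W₀' _ = c
        rw [hI, hI1, mul_one]
      right_inv := fun T => (hgen T).symm }
  refine ⟨⟨(Module.Basis.singleton Unit R).map e, fun W W' Φ => ?_⟩, ?_⟩
  · have h : (Module.Basis.singleton Unit R).map e () = I := by
      rw [Module.Basis.map_apply, Module.Basis.singleton_apply]
      exact one_smul R I
    rw [h, hI]
  -- The right-hand side of the functional equation is an invariant form too.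
  let J : trilinearForms (whittakerRep χ V).ρ (whittakerRep χ⁻¹ V').ρ
      (functionRep F R (m + 1)) :=
    ⟨zetaTrilinear ((tildeLinear F R (m + 1)).comp (whittakerModel χ V).subtype)
        ((tildeLinear F R (m + 1)).comp (whittakerModel χ⁻¹ V').subtype)
        (fourierLinear χ (m + 1)),
      fun g W W' Φ => by
        erw [zetaTrilinear_apply, zetaTrilinear_apply]
        show zetaSum (tilde (rightTranslation F R (m + 1) g W.val))
          (tilde (rightTranslation F R (m + 1) g W'.val))
          (finiteFourier χ (functionRep F R (m + 1) g Φ)) =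
            zetaSum (tilde W.val) (tilde W'.val) (finiteFourier χ Φ)
        rw [tilde_rightTranslation, tilde_rightTranslation, finiteFourier_functionRep]
        exact zetaSum_translate hq (tilde_mem_whittakerSpace (hle W.2))
          (tilde_mem_whittakerSpace (hle' W'.2)) _ _⟩
  have hJ (W : whittakerModel χ V) (W' : whittakerModel χ⁻¹ V') (Φ : (Fin (m + 1) → F) → R) :
      J.val W W' Φ = zetaSum (tilde W.val) (tilde W'.val) (finiteFourier χ Φ) :=
    zetaTrilinear_apply _ _ _ W W' Φ
  set γ := J.val W₀ W₀' (Pi.single (eta F (m + 1)) 1) with hγ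
  have hJI (W : whittakerModel χ V) (W' : whittakerModel χ⁻¹ V') (Φ : (Fin (m + 1) → F) → R) :
      zetaSum W.val W'.val Φ * γ = zetaSum (tilde W.val) (tilde W'.val) (finiteFourier χ Φ) := by
    rw [← hJ, hgen J, mul_comm, ← hI]
    rfl
  -- `J` takes the value `1`, for the same reason as `I`, so that `γ` is a unit.
  have hunit : IsUnit γ := by
    obtain ⟨W, hW, hW1⟩ := exists_tilde_rightEquivariant hq hV
    obtain ⟨W', -, hW'1⟩ := exists_tilde_rightEquivariant hq hV'
    obtain ⟨Φ, hΦ⟩ := exists_finiteFourier_eq_single hq hχ (eta F (m + 1))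
    have h := hJI W W' Φ
    rw [hΦ, zetaSum_single_eta hq (sum_inv_eq_zero hχ) (tilde_mem_whittakerSpace (hle W.2)) hW hW1
      (tilde_mem_whittakerSpace (hle' W'.2)) hW'1] at h
    exact IsUnit.of_mul_eq_one_right _ h
  obtain ⟨u, hu⟩ := hunit
  refine ⟨u, fun W hW W' hW' Φ => hu ▸ hJI ⟨W, hW⟩ ⟨W', hW'⟩ Φ, fun u' hu' => Units.ext ?_⟩
  have h1 := hu' _ W₀.2 _ W₀'.2 (Pi.single (eta F (m + 1)) 1)
  rw [← hJI W₀ W₀', hI1, one_mul, one_mul] at h1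
  rw [h1, hu]

end FunctionalEquation

end FiniteWhittaker

theorem mainTheorem2 (p : ℕ) [Fact p.Prime] {F : Type*} [Field F] [Fintype F] [CharP F p]
    (ψ : AddChar F (BaseRing p)) (hψ : ψ ≠ 1)
    {R : Type*} [CommRing R] [Nontrivial R] [Algebra (BaseRing p) R]
    (n : ℕ) (hn : 1 ≤ n) (V V' : Rep R (GL (Fin n) F))
    (hV : IsWhittakerType (extendChar R ψ) V) (hV' : IsWhittakerType (extendChar R ψ) V')
    (hVV' : ¬ IsExceptionalPair (extendChar R ψ) V V') :
    (∃ b : Module.Basis Unit R (trilinearForms (whittakerRep (extendChar R ψ) V).ρ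
          (whittakerRep (extendChar R ψ)⁻¹ V').ρ (functionRep F R n)),
        ∀ (W : whittakerModel (extendChar R ψ) V) (W' : whittakerModel (extendChar R ψ)⁻¹ V')
          (Φ : (Fin n → F) → R),
          (b ()).val W W' Φ = zetaSum W.val W'.val Φ) ∧
      ∃! γ : Rˣ, ∀ W ∈ whittakerModel (extendChar R ψ) V,
        ∀ W' ∈ whittakerModel (extendChar R ψ)⁻¹ V', ∀ Φ : (Fin n → F) → R,
          zetaSum W W' Φ * (γ : R) =
            zetaSum (tilde W) (tilde W') (finiteFourier (extendChar R ψ) Φ) := by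
  obtain ⟨m, rfl⟩ := Nat.exists_eq_add_of_le' hn
  exact functionalEquation (isUnit_card p F R) (sum_extendChar hψ R) hV hV' hVV'
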